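/- Let $X$ be a real or complex Banach space with scalar field $\mathbb K$. For $2\le q<\infty$, $X$ has cotype $q$ if there is $C\ge 0$ such that $$\Big(\sum_{k=1}^n\|x_k\|^q\Big)^{1/q}\le C\Big(2^{-n}\sum_{\varepsilon\in\{-1,1\}^n}\Big\|\sum_{k=1}^n\varepsilon_kx_k\Big\|^2\Big)^{1/2}$$ for all $n$ and $x_1,\dots,x_n\in X$; every $X$ has cotype $\infty$. Let $\cot X\in[2,\infty]$ be the infimum of the cotypes of $X$. A sequence $(x_j)_{j=1}^\infty$ in $X$ is weakly $r$-summable if $\sum_j|\varphi(x_j)|^r<\infty$ for every continuous linear functional $\varphi$ on $X$. A continuous scalar-valued $2$-homogeneous polynomial on $X$ is a map $P(x)=A(x,x)$ with $A:X\times X\to\mathbb K$ continuous and bilinear. For $r>0$, such a $P$ is $r$-dominated if $\sum_j|P(x_j)|^{r/2}<\infty$ for every weakly $r$-summable sequence $(x_j)_{j=1}^\infty$ in $X$. Theorem. Suppose $\cot X=q>2$, where $q\in(2,\infty]$, and let $q^*$ be its conjugate, $\frac1q+\frac1{q^*}=1$ (so $q^*=1$ if $q=\infty$). Then for every real $r$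 with $1\le r<q^*$ some continuous scalar-valued $2$-homogeneous polynomial on $X$ is not $r$-dominated. In other words, $$\mathcal P_X:=\inf\{r>0:\text{every continuous scalar-valued $2$-homogeneous polynomial on $X$ is $r$-dominated}\}\ge q^*,$$ where $\inf\emptyset=\infty$. -/

import Mathlib

open scoped ENNReal

noncomputable section

/-- `X` has (Rademacher) cotype `q`: there is a constant `C ≥ 0` such that for all finite families
`x₁, …, xₙ` of vectors,
`(∑ ‖xₖ‖ ^ q) ^ (1/q) ≤ C * (average over all signs ε ∈ {-1, 1}ⁿ of ‖∑ εₖ xₖ‖ ^ 2) ^ (1/2)`.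
The average is the integral over `[0, 1]` of `‖∑ rₖ(t) xₖ‖ ^ 2`, with `rₖ` the Rademacher
functions. -/
def HasCotype (X : Type*) [NormedAddCommGroup X] (q : ℝ) : Prop :=
  ∃ C : ℝ, 0 ≤ C ∧ ∀ (n : ℕ) (x : Fin n → X),
    (∑ k, ‖x k‖ ^ q) ^ (1 / q) ≤
      C * √((∑ ε : Fin n → ℤˣ, ‖∑ k, (ε k : ℤ) • x k‖ ^ 2) / 2 ^ n)

/-- `cot X`, the infimum of the cotypes `q ∈ [2, ∞]` of `X`. Every space has cotype `∞`, so the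
infimum is taken over the finite cotypes and is `∞` if there are none. -/
def cot (X : Type*) [NormedAddCommGroup X] : ℝ≥0∞ :=
  ⨅ (q : ℝ) (_ : 2 ≤ q ∧ HasCotype X q), ENNReal.ofReal q

/-- A sequence `(xⱼ)` in `X` is weakly `r`-summable: `∑ⱼ |φ(xⱼ)| ^ r < ∞` for every continuous
linear functional `φ` on `X`. -/
def WeaklySummable (𝕜 : Type*) [RCLike 𝕜] {X : Type*} [NormedAddCommGroup X] [NormedSpace 𝕜 X]
    (r : ℝ) (x : ℕ → X) : Prop :=
  ∀ φ : X →L[𝕜] 𝕜, Summable fun j => ‖φ (x j)‖ ^ r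

/-- The continuous scalar-valued `m`-homogeneous polynomials on `X`: the diagonal restrictions of
continuous `m`-linear forms on `X ^ m`. -/
def contHomPoly (𝕜 : Type*) [RCLike 𝕜] (m : ℕ) (X : Type*) [NormedAddCommGroup X]
    [NormedSpace 𝕜 X] : Set (X → 𝕜) :=
  {P | ∃ A : ContinuousMultilinearMap 𝕜 (fun _ : Fin m => X) 𝕜, ∀ x, P x = A fun _ => x}

/-- The `r`-dominated scalar-valued `m`-homogeneous polynomials on `X` (for `r > 0`): the
continuous ones for which `(P(xⱼ)) ∈ ℓ_{r/m}` whenever `(xⱼ)` is weakly `r`-summable. -/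
def dominatedHomPoly (𝕜 : Type*) [RCLike 𝕜] (r : ℝ) (m : ℕ) (X : Type*) [NormedAddCommGroup X]
    [NormedSpace 𝕜 X] : Set (X → 𝕜) :=
  {P | P ∈ contHomPoly 𝕜 m X ∧
    ∀ x : ℕ → X, WeaklySummable 𝕜 r x → Summable fun j => ‖P (x j)‖ ^ (r / m)}

/-- The infimum (in `[0, ∞]`) of the `r > 0` for which every continuous scalar-valued
`2`-homogeneous polynomial on `X` is `r`-dominated; it is `∞` if there is no such `r`. -/
def dominatedIndex (𝕜 : Type*) [RCLike 𝕜] (X : Type*) [NormedAddCommGroup X]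
    [NormedSpace 𝕜 X] : ℝ≥0∞ :=
  ⨅ (r : ℝ) (_ : 0 < r ∧ dominatedHomPoly 𝕜 r 2 X = contHomPoly 𝕜 2 X), ENNReal.ofReal r

end

open scoped BigOperators

set_option linter.unusedSectionVars false

/-! ### Averages over independent signs. -/

section SignAverages

variable {ι κ : Type*} [Fintype ι] [Fintype κ] [DecidableEq ι] [DecidableEq κ]

/-! Put κ = 1/q < 1/2. Given m vectors of norm at least 1, let φₖ norm xₖ and consider the forms m⁻¹
∑ ±φₖ ⊗ φₖ, of norm at most 1. For random signs the mean of ∑ |P(xₖ)|^(r/2) is at least m^(1 - r/2)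
/ 2. If all polynomials were r-dominated, Baire category would bound such sums uniformly over the
unit ball of forms along each weakly r-summable sequence. So it suffices to find families with ∑
|φ(xₖ)|^r = o(m^(1 - r/2)) ‖φ‖^r and to glue rescaled copies of them
(`dominatedHomPoly_ne_of_families`).

Failure of cotype just below q gives n vectors with Rademacher average of order at most n^(κ + η),
but control over all signs, that is, a weak ℓ₁ bound, is needed. Put the vectors in an m × m^L array
and pick one per row at random. Symmetrization and contraction bound the worst signs by a
Cauchy–Schwarz mean term and the Rademacher mean of the selection, which is small by cotype just
above q. As κ < 1/2, a large L makes the first term no larger than the second. The result is m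
vectors with signed sums O(m^(κ + η)) (`exists_family_signSum_le`).

For r ≤ 1 this makes the j-th largest |φ(xₖ)| at most of order m^(κ + η) / j, which is enough. For r
> 1 cotype s near q is used again: after discarding at most half of the vectors, signed sums over
any remaining T are of order |T|^(1/s), up to a small power of m (`exists_finset_forall_disjoint`),
so the decay is j^(-(1 - 1/s)). In both cases the weak sums are about m^(1 - r(1 - κ)), and 1 - κ >
1/2. The hypothesis r < q* says r(1 - κ) < 1, so that ∑ j^(-r(1 - 1/s)) is still governed by its
last terms up to small powers of m. -/

theorem expect_mul_const {G : Type*} [Group G] [Fintype G] (F : G → ℝ) (g : G) :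
    𝔼 h, F (h * g) = 𝔼 h, F h :=
  Fintype.expect_equiv (Equiv.mulRight g) _ _ fun _ => rfl

/-- Any δ extends along the injection by 1, so the left side is invariant under translation by δ;
averaging over δ as well gives the right side. -/
theorem expect_signs_comp (j : κ → ι) (hj : Function.Injective j) (F : (κ → ℤˣ) → ℝ) :
    𝔼 ε : ι → ℤˣ, F (ε ∘ j) = 𝔼 δ, F δ := by
  have key : ∀ δ : κ → ℤˣ, 𝔼 ε : ι → ℤˣ, F (ε ∘ j) = 𝔼 ε : ι → ℤˣ, F (δ * (ε ∘ j)) := by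
    intro δ
    rw [← expect_mul_const (fun ε : ι → ℤˣ => F (ε ∘ j)) (Function.extend j δ 1)]
    refine Finset.expect_congr rfl fun ε _ => congrArg F ?_
    funext k
    simp [hj.extend_apply, mul_comm]
  calc 𝔼 ε : ι → ℤˣ, F (ε ∘ j)
      = 𝔼 δ : κ → ℤˣ, 𝔼 ε : ι → ℤˣ, F (δ * (ε ∘ j)) := by
        rw [← Fintype.expect_const (ι := κ → ℤˣ) (𝔼 ε : ι → ℤˣ, F (ε ∘ j))]
        exact Finset.expect_congr rfl fun δ _ => key δ
    _ = 𝔼 ε : ι → ℤˣ, 𝔼 δ : κ → ℤˣ, F (δ * (ε ∘ j)) := Finset.expect_comm _ _ _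
    _ = 𝔼 δ, F δ := by simp only [expect_mul_const, Fintype.expect_const]

theorem intUnits_coe_real_sq (u : ℤˣ) : ((u : ℤ) : ℝ) * ((u : ℤ) : ℝ) = 1 := by
  rcases Int.units_eq_one_or u with h | h <;> simp [h]

theorem expect_sign_mul_sign (k l : ι) :
    𝔼 ε : ι → ℤˣ, (((ε k : ℤ) : ℝ) * ((ε l : ℤ) : ℝ)) = if k = l then 1 else 0 := by
  split_ifs with h
  · subst h
    simp only [intUnits_coe_real_sq, Fintype.expect_const]
  · have := expect_mul_const (fun ε : ι → ℤˣ => ((ε k : ℤ) : ℝ) * ((ε l : ℤ) : ℝ))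
      (Pi.mulSingle k (-1))
    simp only [Pi.mul_apply, Pi.mulSingle_eq_same, Pi.mulSingle_eq_of_ne (Ne.symm h),
      mul_one, Units.val_neg, mul_neg, Int.cast_neg, neg_mul,
      Finset.expect_neg_distrib] at this
    linarith

theorem expect_sq_sum_signs (c : ι → ℝ) :
    𝔼 ε : ι → ℤˣ, (∑ k, ((ε k : ℤ) : ℝ) * c k) ^ 2 = ∑ k, c k ^ 2 := by
  have : ∀ ε : ι → ℤˣ, (∑ k, ((ε k : ℤ) : ℝ) * c k) ^ 2 =
      ∑ k, ∑ l, (((ε k : ℤ) : ℝ) * ((ε l : ℤ) : ℝ)) * (c k * c l) := by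
    intro ε
    rw [sq, Finset.sum_mul_sum]
    refine Finset.sum_congr rfl fun k _ => Finset.sum_congr rfl fun l _ => by ring
  simp only [this, Finset.expect_sum_comm, ← Finset.expect_mul, expect_sign_mul_sign]
  refine Finset.sum_congr rfl fun k _ => ?_
  simp [sq]

end SignAverages

/-! ### Signed sums, their averages, and subfamilies. -/

section RademacherAverages

variable {X : Type*} [NormedAddCommGroup X] [NormedSpace ℝ X]
variable {ι κ : Type*} [Fintype ι] [Fintype κ] [DecidableEq ι] [DecidableEq κ]

/-- The signed sum `∑ εₖ xₖ`. -/
def signSum {X ι : Type*} [NormedAddCommGroup X] [Fintype ι] (ε : ι → ℤˣ) (x : ι → X) : X :=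
  ∑ k, (ε k : ℤ) • x k

/-- The mean of the norms of the signed sums of a finite family. -/
noncomputable def radMean {X ι : Type*} [NormedAddCommGroup X] [Fintype ι] [DecidableEq ι] (x : ι → X) : ℝ :=
  𝔼 ε, ‖signSum ε x‖

/-- The quadratic mean of the norms of the signed sums of a finite family. -/
noncomputable def radAvg {X ι : Type*} [NormedAddCommGroup X] [Fintype ι] [DecidableEq ι] (x : ι → X) : ℝ :=
  √(𝔼 ε, ‖signSum ε x‖ ^ 2)

theorem radAvg_nonneg (x : ι → X) : 0 ≤ radAvg x := Real.sqrt_nonneg _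

theorem radAvg_sq (x : ι → X) : radAvg x ^ 2 = 𝔼 ε, ‖signSum ε x‖ ^ 2 :=
  Real.sq_sqrt (Finset.expect_nonneg fun _ _ => by positivity)

theorem expect_le_sqrt_expect_sq {β : Type*} [Fintype β] [Nonempty β] (f : β → ℝ) :
    𝔼 b, f b ≤ √(𝔼 b, f b ^ 2) := by
  apply Real.le_sqrt_of_sq_le
  simpa using Finset.expect_mul_sq_le_sq_mul_sq Finset.univ f (fun _ => (1 : ℝ))

theorem map_signSum {ι : Type*} [Fintype ι] {F : Type*} [FunLike F X ℝ] [AddMonoidHomClass F X ℝ] (φ : F) (ε : ι → ℤˣ)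
    (x : ι → X) : φ (signSum ε x) = ∑ k, ((ε k : ℤ) : ℝ) * φ (x k) := by
  simp [signSum, map_sum, map_zsmul]

theorem signSum_smul (t : ℝ) (ε : ι → ℤˣ) (x : ι → X) :
    signSum ε (fun k => t • x k) = t • signSum ε x := by
  simp only [signSum, Finset.smul_sum]
  exact Finset.sum_congr rfl fun k _ => (smul_comm _ _ _)

theorem radAvg_smul {t : ℝ} (ht : 0 ≤ t) (x : ι → X) :
    radAvg (fun k => t • x k) = t * radAvg x := by
  simp only [radAvg, signSum_smul, norm_smul, mul_pow, ← Finset.mul_expect, Real.norm_eq_abs,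
    sq_abs]
  rw [Real.sqrt_mul (by positivity), Real.sqrt_sq ht]

/-- Flipping all signs outside the range of `j` and averaging cancels the other vectors. Hence
passing to a subfamily increases neither the quadratic mean nor the maximum of the signed sums. -/
theorem exists_signSum_comp_eq_half_add (j : κ → ι) (hj : Function.Injective j) (x : ι → X) :
    ∃ δ : ι → ℤˣ, ∀ ε : ι → ℤˣ, signSum (ε ∘ j) (x ∘ j) =
      (1 / 2 : ℝ) • (signSum ε x + signSum (ε * δ) x) := by
  classical
  refine ⟨fun i => if i ∈ Set.range j then 1 else -1, fun ε => ?_⟩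
  have h1 : signSum (ε ∘ j) (x ∘ j) = ∑ i, if i ∈ Set.range j then (ε i : ℤ) • x i else 0 := by
    rw [← Finset.sum_filter]
    have : (Finset.univ.filter fun i => i ∈ Set.range j) = Finset.univ.map ⟨j, hj⟩ := by
      ext i; simp
    rw [this, Finset.sum_map]
    rfl
  rw [h1, signSum, signSum, ← Finset.sum_add_distrib, Finset.smul_sum]
  refine Finset.sum_congr rfl fun i _ => ?_
  by_cases h : i ∈ Set.range j
  · simp only [h, if_true, Pi.mul_apply, mul_one, ← two_smul ℝ, smul_smul]
    norm_num
  · have : (ε * (fun i => if i ∈ Set.range j then 1 else -1 : ι → ℤˣ)) i = -ε i := by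
      rw [Pi.mul_apply, if_neg h, mul_neg, mul_one]
    rw [if_neg h, this]
    simp

theorem radAvg_comp_le (j : κ → ι) (hj : Function.Injective j) (x : ι → X) :
    radAvg (x ∘ j) ≤ radAvg x := by
  obtain ⟨δ, hδ⟩ := exists_signSum_comp_eq_half_add j hj x
  apply Real.sqrt_le_sqrt
  calc 𝔼 ε : κ → ℤˣ, ‖signSum ε (x ∘ j)‖ ^ 2
      = 𝔼 ε : ι → ℤˣ, ‖signSum (ε ∘ j) (x ∘ j)‖ ^ 2 :=
        (expect_signs_comp j hj fun ε => ‖signSum ε (x ∘ j)‖ ^ 2).symm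
    _ ≤ 𝔼 ε : ι → ℤˣ, ((1 / 2) * ‖signSum ε x‖ ^ 2 + (1 / 2) * ‖signSum (ε * δ) x‖ ^ 2) := by
        refine Finset.expect_le_expect fun ε _ => ?_
        rw [hδ, norm_smul, Real.norm_of_nonneg (by norm_num)]
        have := norm_add_le (signSum ε x) (signSum (ε * δ) x)
        have h0 := norm_nonneg (signSum ε x + signSum (ε * δ) x)
        nlinarith [sq_nonneg (‖signSum ε x‖ - ‖signSum (ε * δ) x‖)]
    _ = 𝔼 ε, ‖signSum ε x‖ ^ 2 := by
        rw [Finset.expect_add_distrib, ← Finset.mul_expect, ← Finset.mul_expect,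
          expect_mul_const (fun ε : ι → ℤˣ => ‖signSum ε x‖ ^ 2)]
        ring

theorem norm_signSum_comp_le (j : κ → ι) (hj : Function.Injective j) (x : ι → X) {W : ℝ}
    (hW : ∀ ε, ‖signSum ε x‖ ≤ W) (ε : κ → ℤˣ) : ‖signSum ε (x ∘ j)‖ ≤ W := by
  obtain ⟨δ, hδ⟩ := exists_signSum_comp_eq_half_add j hj x
  have h := hδ (Function.extend j ε 1)
  have h2 : Function.extend j ε 1 ∘ j = ε := by
    funext k; simp [hj.extend_apply]
  rw [h2] at h
  rw [h, norm_smul, Real.norm_of_nonneg (by norm_num)]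
  have := norm_add_le (signSum (Function.extend j ε 1) x) (signSum (Function.extend j ε 1 * δ) x)
  have := hW (Function.extend j ε 1)
  have := hW (Function.extend j ε 1 * δ)
  linarith

theorem norm_le_radAvg (x : ι → X) (k : ι) : ‖x k‖ ≤ radAvg x := by
  refine le_trans (le_of_eq ?_) (radAvg_comp_le (fun _ : Unit => k) (fun _ _ _ => rfl) x)
  have : ∀ ε : Unit → ℤˣ, ‖signSum ε (x ∘ fun _ : Unit => k)‖ = ‖x k‖ := by
    intro ε
    rcases Int.units_eq_one_or (ε ()) with h | h <;> simp [signSum, h]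
  simp [radAvg, this]

theorem sum_sq_le_radAvg_sq (x : ι → X) (φ : X →L[ℝ] ℝ) (hφ : ‖φ‖ ≤ 1) :
    ∑ k, φ (x k) ^ 2 ≤ radAvg x ^ 2 := by
  rw [radAvg_sq, ← expect_sq_sum_signs]
  refine Finset.expect_le_expect fun ε _ => ?_
  rw [← map_signSum, ← sq_abs]
  have : |φ (signSum ε x)| ≤ ‖signSum ε x‖ := by
    simpa using φ.le_of_opNorm_le hφ (signSum ε x)
  gcongr

/-- Orthonormality of the signs gives the ℓ₂ bound, Cauchy–Schwarz the ℓ₁ bound. This controls the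
mean term in the random selection. -/
theorem sum_abs_le_radAvg (x : ι → X) (φ : X →L[ℝ] ℝ) (hφ : ‖φ‖ ≤ 1) :
    ∑ k, |φ (x k)| ≤ √(Fintype.card ι) * radAvg x := by
  have h := sum_sq_le_radAvg_sq x φ hφ
  have h1 : (∑ k, |φ (x k)|) ^ 2 ≤ Fintype.card ι * ∑ k, φ (x k) ^ 2 := by
    have := sq_sum_le_card_mul_sum_sq (s := Finset.univ) (f := fun k => |φ (x k)|)
    simpa using this
  refine (pow_le_pow_iff_left₀ (by positivity)
    (mul_nonneg (Real.sqrt_nonneg _) (radAvg_nonneg x)) two_ne_zero).1 ?_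
  rw [mul_pow, Real.sq_sqrt (by positivity)]
  exact h1.trans (by gcongr)

theorem exists_sign_sum_abs {ι : Type*} [Fintype ι] (x : ι → X) (φ : X →L[ℝ] ℝ) :
    ∃ ε : ι → ℤˣ, φ (signSum ε x) = ∑ k, |φ (x k)| := by
  refine ⟨fun k => if 0 ≤ φ (x k) then 1 else -1, ?_⟩
  rw [map_signSum]
  refine Finset.sum_congr rfl fun k _ => ?_
  split_ifs with h
  · simp [abs_of_nonneg h]
  · simp [abs_of_neg (not_le.1 h)]

theorem sum_abs_le_of_signSum_le {ι : Type*} [Fintype ι] (x : ι → X) {W : ℝ}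
    (hW : ∀ ε, ‖signSum ε x‖ ≤ W) (φ : X →L[ℝ] ℝ) :
    ∑ k, |φ (x k)| ≤ ‖φ‖ * W := by
  obtain ⟨ε, hε⟩ := exists_sign_sum_abs x φ
  rw [← hε]
  exact (le_abs_self _).trans ((φ.le_opNorm _).trans (by gcongr; exact hW ε))

end RademacherAverages

/-! ### Contraction principle for absolute values. -/

section Contraction

variable {ι α : Type*} [Finite ι] [Nonempty ι] [Fintype α] [DecidableEq α]

/-- Take maximizers `i`, `j` on the left. If `t i` and `t j` have the same sign, the two terms
already occur in different suprema on the right; otherwise use -|t j| ≤ |t j| first. -/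
theorem ciSup_add_abs_add_ciSup_sub_abs_le (c t : ι → ℝ) :
    (⨆ i, (c i + |t i|)) + (⨆ i, (c i - |t i|)) ≤ (⨆ i, (c i + t i)) + (⨆ i, (c i - t i)) := by
  obtain ⟨i, hi⟩ := exists_eq_ciSup_of_finite (f := fun i => c i + |t i|)
  obtain ⟨j, hj⟩ := exists_eq_ciSup_of_finite (f := fun i => c i - |t i|)
  rw [← hi, ← hj]
  have h1 := Finite.le_ciSup (fun i => c i + t i)
  have h2 := Finite.le_ciSup (fun i => c i - t i)
  have h3 := h1 i; have h4 := h1 j; have h5 := h2 i; have h6 := h2 j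
  beta_reduce at h3 h4 h5 h6 ⊢
  rcases abs_cases (t i) with ⟨hti, _⟩ | ⟨hti, _⟩ <;>
    rcases abs_cases (t j) with ⟨htj, _⟩ | ⟨htj, _⟩ <;> rw [hti, htj] <;> linarith

theorem expect_eq_expect_half_add_flip (F : (α → ℤˣ) → ℝ) (a : α) :
    𝔼 ε, F ε = 𝔼 ε, (1 / 2) * (F ε + F (ε * Pi.mulSingle a (-1))) := by
  rw [← Finset.mul_expect, Finset.expect_add_distrib, expect_mul_const F]
  ring

theorem expect_ciSup_abs_step (c : (α → ℤˣ) → ι → ℝ) (t : ι → ℝ) (a : α)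
    (hc : ∀ ε, c (ε * Pi.mulSingle a (-1)) = c ε) :
    𝔼 ε : α → ℤˣ, (⨆ i, (c ε i + ((ε a : ℤ) : ℝ) * |t i|)) ≤
      𝔼 ε : α → ℤˣ, (⨆ i, (c ε i + ((ε a : ℤ) : ℝ) * t i)) := by
  rw [expect_eq_expect_half_add_flip _ a,
    expect_eq_expect_half_add_flip (fun ε => ⨆ i, (c ε i + ((ε a : ℤ) : ℝ) * t i)) a]
  refine Finset.expect_le_expect fun ε _ => mul_le_mul_of_nonneg_left ?_ (by norm_num)
  have := ciSup_add_abs_add_ciSup_sub_abs_le (c ε) t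
  rcases Int.units_eq_one_or (ε a) with h | h
  · simpa [hc, h, ← sub_eq_add_neg] using this
  · simp only [hc, h, Pi.mul_apply, Pi.mulSingle_eq_same, mul_neg, mul_one, neg_neg, Units.val_neg,
      Units.val_one, Int.cast_neg, Int.cast_one, neg_mul, one_mul, ← sub_eq_add_neg]
    linarith

/-- A contraction principle: taking absolute values does not increase the mean of the supremum of
a finite family of signed sums. -/
theorem expect_ciSup_abs_le (f : ι → α → ℝ) :
    𝔼 ε : α → ℤˣ, (⨆ i, ∑ a, ((ε a : ℤ) : ℝ) * |f i a|) ≤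
      𝔼 ε : α → ℤˣ, (⨆ i, ∑ a, ((ε a : ℤ) : ℝ) * f i a) := by
  have key : ∀ S : Finset α,
      𝔼 ε : α → ℤˣ, (⨆ i, ∑ a, ((ε a : ℤ) : ℝ) * (if a ∈ S then |f i a| else f i a)) ≤
      𝔼 ε : α → ℤˣ, (⨆ i, ∑ a, ((ε a : ℤ) : ℝ) * f i a) := by
    intro S
    induction S using Finset.induction_on with
    | empty => simp
    | insert a S ha ih =>
      refine le_trans ?_ ih
      have h := expect_ciSup_abs_step (fun (ε : α → ℤˣ) i => ∑ b ∈ Finset.univ.erase a,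
        ((ε b : ℤ) : ℝ) * (if b ∈ S then |f i b| else f i b)) (fun i => f i a) a (by
          intro ε
          funext i
          refine Finset.sum_congr rfl fun b hb => ?_
          simp [Pi.mulSingle_eq_of_ne (Finset.ne_of_mem_erase hb)])
      refine le_trans (le_of_eq ?_) (h.trans (le_of_eq ?_))
      · refine Finset.expect_congr rfl fun ε _ => iSup_congr fun i => ?_
        rw [← Finset.sum_erase_add _ _ (Finset.mem_univ a), if_pos (Finset.mem_insert_self a S)]
        congr 1
        refine Finset.sum_congr rfl fun b hb => ?_
        simp [Finset.mem_insert, Finset.ne_of_mem_erase hb]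
      · refine Finset.expect_congr rfl fun ε _ => iSup_congr fun i => ?_
        rw [← Finset.sum_erase_add _ _ (Finset.mem_univ a), if_neg ha]
  simpa using key Finset.univ

theorem ciSup_add_le_add_ciSup (f g : ι → ℝ) : (⨆ i, (f i + g i)) ≤ (⨆ i, f i) + ⨆ i, g i :=
  ciSup_le fun i => add_le_add (Finite.le_ciSup f i) (Finite.le_ciSup g i)

theorem ciSup_expect_le {β : Type*} [Fintype β] [Nonempty β] (f : β → ι → ℝ) :
    (⨆ i, 𝔼 b, f b i) ≤ 𝔼 b, ⨆ i, f b i :=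
  ciSup_le fun i => Finset.expect_le_expect fun b _ => Finite.le_ciSup (f b) i

end Contraction

/-! ### Symmetrization of a random selection. -/

section Symmetrization

variable {ι α G : Type*} [Finite ι] [Nonempty ι] [Fintype α] [DecidableEq α]
  [Fintype G] [Nonempty G]

theorem expect_pi_apply (a : α) (g : G → ℝ) : 𝔼 τ : α → G, g (τ a) = 𝔼 b, g b := by
  have h := Fintype.expect_equiv (Equiv.funSplitAt a G) (fun τ : α → G => g (τ a))
    (fun p : G × ({j // j ≠ a} → G) => g p.1) (fun _ => rfl)
  rw [h, ← Finset.univ_product_univ, Finset.expect_product]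
  simp only [Fintype.expect_const]

/-- Exchanging the two independent choices in the rows where `ε` is -1 is an involution of the
pairs, hence preserves their uniform distribution. -/
theorem expect_swap (H : (α → G) → (α → G) → ℝ) (ε : α → ℤˣ) :
    𝔼 τ : α → G, 𝔼 τ' : α → G, H τ τ' =
      𝔼 τ : α → G, 𝔼 τ' : α → G, H (fun a => if ε a = 1 then τ a else τ' a)
        (fun a => if ε a = 1 then τ' a else τ a) := by
  have h : ∀ K : (α → G) → (α → G) → ℝ, 𝔼 τ : α → G, 𝔼 τ' : α → G, K τ τ' =
      𝔼 p : (α → G) × (α → G), K p.1 p.2 := fun K => by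
    rw [← Finset.univ_product_univ, Finset.expect_product]
  rw [h, h]
  let e : (α → G) × (α → G) ≃ (α → G) × (α → G) :=
    Function.Involutive.toPerm (fun p => (fun a => if ε a = 1 then p.1 a else p.2 a,
      fun a => if ε a = 1 then p.2 a else p.1 a)) fun p => by
        ext a <;> by_cases h : ε a = 1 <;> simp [h]
  exact (Fintype.expect_equiv e _ _ fun p => rfl).symm

/-- Symmetrization for a random choice of one entry in every row of an array. -/
theorem expect_ciSup_sum_le (g : ι → α → G → ℝ) :
    𝔼 τ : α → G, (⨆ i, ∑ a, g i a (τ a)) ≤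
      (⨆ i, ∑ a, 𝔼 b, g i a b) +
        2 * 𝔼 τ : α → G, 𝔼 ε : α → ℤˣ, ⨆ i, ∑ a, ((ε a : ℤ) : ℝ) * g i a (τ a) := by
  set S : (α → G) → (α → G) → ℝ := fun τ τ' => ⨆ i, ∑ a, (g i a (τ a) - g i a (τ' a)) with hS
  set T : (α → G) → (α → ℤˣ) → ℝ := fun τ ε => ⨆ i, ∑ a, ((ε a : ℤ) : ℝ) * g i a (τ a) with hT
  have h1 : ∀ τ : α → G, (⨆ i, ∑ a, g i a (τ a)) ≤ (⨆ i, ∑ a, 𝔼 b, g i a b) + 𝔼 τ', S τ τ' := by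
    intro τ
    refine le_trans (le_of_eq ?_) ((ciSup_add_le_add_ciSup (fun i => ∑ a, 𝔼 b, g i a b)
      (fun i => 𝔼 τ' : α → G, ∑ a, (g i a (τ a) - g i a (τ' a)))).trans
      (add_le_add le_rfl (ciSup_expect_le _)))
    refine iSup_congr fun i => ?_
    rw [Finset.expect_sum_comm, ← Finset.sum_add_distrib]
    refine Finset.sum_congr rfl fun a _ => ?_
    rw [Finset.expect_sub_distrib, Fintype.expect_const, expect_pi_apply a (g i a)]
    ring
  have h2 : ∀ ε : α → ℤˣ, 𝔼 τ, 𝔼 τ', S τ τ' ≤ 𝔼 τ, T τ ε + 𝔼 τ, T τ (-ε) := by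
    intro ε
    rw [expect_swap S ε]
    calc _ ≤ 𝔼 τ : α → G, 𝔼 τ' : α → G, (T τ ε + T τ' (-ε)) := by
          refine Finset.expect_le_expect fun τ _ => Finset.expect_le_expect fun τ' _ => ?_
          refine le_trans (le_of_eq ?_) (ciSup_add_le_add_ciSup _ _)
          refine iSup_congr fun i => ?_
          rw [← Finset.sum_add_distrib]
          refine Finset.sum_congr rfl fun a _ => ?_
          rcases Int.units_eq_one_or (ε a) with h | h
          · simp [h]; ring
          · simp [h]; ring
      _ = _ := by
          simp only [Finset.expect_add_distrib, Fintype.expect_const]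
  have h3 : 𝔼 τ, 𝔼 τ', S τ τ' ≤ 2 * 𝔼 τ, 𝔼 ε, T τ ε := by
    rw [← Fintype.expect_const (ι := α → ℤˣ) (𝔼 τ, 𝔼 τ', S τ τ')]
    refine (Finset.expect_le_expect fun ε _ => h2 ε).trans (le_of_eq ?_)
    rw [Finset.expect_add_distrib, Finset.expect_comm,
      Finset.expect_comm (f := fun (ε : α → ℤˣ) (τ : α → G) => T τ (-ε)), two_mul]
    congr 1
    refine Finset.expect_congr rfl fun τ _ => ?_
    exact Fintype.expect_equiv (Equiv.neg _) _ _ fun ε => rfl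
  calc _ ≤ 𝔼 τ : α → G, ((⨆ i, ∑ a, 𝔼 b, g i a b) + 𝔼 τ', S τ τ') :=
        Finset.expect_le_expect fun τ _ => h1 τ
    _ ≤ _ := by
        rw [Finset.expect_add_distrib, Fintype.expect_const]
        gcongr

end Symmetrization

/-! ### Random selection of one entry per row. -/

section Selection

variable {X : Type*} [NormedAddCommGroup X] [NormedSpace ℝ X]
variable {α G : Type*} [Fintype α] [DecidableEq α] [AddCommGroup G] [Fintype G] [DecidableEq G]

/-- The translates of the graph of `τ` by elements of `G` partition the array, so one further sign
per translate is only a change of the signs of the array. This is why the columns are indexed by a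
group. -/
theorem signSum_diagonal_sums (x : α × G → X) (τ : α → G) (ε : α × G → ℤˣ) (θ : G → ℤˣ) :
    signSum θ (fun i => signSum (fun a => ε (a, τ a + i)) (fun a => x (a, τ a + i))) =
      signSum (ε * fun p => θ (p.2 - τ p.1)) x := by
  simp only [signSum, Finset.smul_sum, Fintype.sum_prod_type]
  rw [Finset.sum_comm]
  refine Finset.sum_congr rfl fun a _ => ?_
  refine Fintype.sum_equiv (Equiv.addLeft (τ a)) _ _ fun i => ?_
  simp [smul_smul, mul_comm]

theorem expect_radMean_shift_le {D : ℝ} (hD0 : 0 ≤ D)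
    (hD : ∀ y : G → X, ∑ i, ‖y i‖ ≤ D * radAvg y) (x : α × G → X) (τ : α → G) :
    𝔼 i, radMean (fun a => x (a, τ a + i)) ≤ D / Fintype.card G * radAvg x := by
  set y : (α × G → ℤˣ) → G → X := fun ε i =>
    signSum (fun a => ε (a, τ a + i)) (fun a => x (a, τ a + i)) with hy
  have h1 : ∀ i, radMean (fun a => x (a, τ a + i)) = 𝔼 ε, ‖y ε i‖ := by
    intro i
    refine (expect_signs_comp (fun a => (a, τ a + i)) (fun a b h => (Prod.ext_iff.1 h).1)
      (fun ε => ‖signSum ε (fun a => x (a, τ a + i))‖)).symm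
  have h2 : 𝔼 ε, radAvg (y ε) ≤ radAvg x := by
    refine (expect_le_sqrt_expect_sq _).trans (Real.sqrt_le_sqrt (le_of_eq ?_))
    simp only [radAvg_sq]
    rw [Finset.expect_comm]
    have h3 : ∀ θ : G → ℤˣ, 𝔼 ε, ‖signSum θ (y ε)‖ ^ 2 = 𝔼 ε, ‖signSum ε x‖ ^ 2 := by
      intro θ
      rw [← expect_mul_const (fun ε : α × G → ℤˣ => ‖signSum ε x‖ ^ 2)
        (fun p => θ (p.2 - τ p.1))]
      refine Finset.expect_congr rfl fun ε _ => ?_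
      rw [hy, signSum_diagonal_sums]
    simp only [h3, Fintype.expect_const]
  calc 𝔼 i, radMean (fun a => x (a, τ a + i)) = 𝔼 ε, 𝔼 i, ‖y ε i‖ := by
        simp only [h1]; exact Finset.expect_comm _ _ _
    _ ≤ 𝔼 ε, D / Fintype.card G * radAvg (y ε) := by
        refine Finset.expect_le_expect fun ε _ => ?_
        rw [Fintype.expect_eq_sum_div_card, div_mul_eq_mul_div]
        gcongr
        exact hD _
    _ ≤ _ := by
        rw [← Finset.mul_expect]
        gcongr

theorem expect_radMean_le {D : ℝ} (hD0 : 0 ≤ D)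
    (hD : ∀ y : G → X, ∑ i, ‖y i‖ ≤ D * radAvg y) (x : α × G → X) :
    𝔼 τ : α → G, radMean (fun a => x (a, τ a)) ≤ D / Fintype.card G * radAvg x := by
  have h : ∀ i : G, 𝔼 τ : α → G, radMean (fun a => x (a, τ a)) =
      𝔼 τ : α → G, radMean (fun a => x (a, τ a + i)) := fun i =>
    (Fintype.expect_equiv (Equiv.addRight (fun _ : α => i)) _ _ fun τ => rfl).symm
  calc 𝔼 τ : α → G, radMean (fun a => x (a, τ a))
      = 𝔼 i : G, 𝔼 τ : α → G, radMean (fun a => x (a, τ a + i)) := by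
        rw [← Fintype.expect_const (ι := G) (𝔼 τ : α → G, radMean (fun a => x (a, τ a)))]
        exact Finset.expect_congr rfl fun i _ => h i
    _ = 𝔼 τ : α → G, 𝔼 i : G, radMean (fun a => x (a, τ a + i)) := Finset.expect_comm _ _ _
    _ ≤ 𝔼 τ : α → G, D / Fintype.card G * radAvg x :=
        Finset.expect_le_expect fun τ _ => expect_radMean_shift_le hD0 hD x τ
    _ = _ := Fintype.expect_const _

/-- From an array whose columns satisfy an averaged lower estimate one can select one entry in each
row such that all signed sums of the selected vectors are controlled by the quadratic mean of the
signed sums of the whole array. -/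
theorem exists_selection_signSum_le {D : ℝ} (hD0 : 0 ≤ D)
    (hD : ∀ y : G → X, ∑ i, ‖y i‖ ≤ D * radAvg y) (x : α × G → X) :
    ∃ τ : α → G, ∀ θ, ‖signSum θ (fun a => x (a, τ a))‖ ≤
      (√(Fintype.card α * Fintype.card G) + 2 * D) / Fintype.card G * radAvg x := by
  -- Finitely many functionals, norming every signed sum of every selection, replace the dual ball,
  -- so that all suprema are finite.
  choose Φ hΦ1 hΦ2 using fun p : (α → G) × (α → ℤˣ) =>
    exists_dual_vector'' ℝ (signSum p.2 (fun a => x (a, p.1 a)))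
  have hG : (0 : ℝ) < Fintype.card G := by exact_mod_cast Fintype.card_pos
  have h1 := expect_ciSup_sum_le (fun p a b => |Φ p (x (a, b))|)
  have h2 : (⨆ p, ∑ a, 𝔼 b, |Φ p (x (a, b))|) ≤
      √(Fintype.card α * Fintype.card G) / Fintype.card G * radAvg x := by
    refine ciSup_le fun p => ?_
    have := sum_abs_le_radAvg x (Φ p) (hΦ1 p)
    rw [Fintype.card_prod, Fintype.sum_prod_type, Nat.cast_mul] at this
    simp only [Fintype.expect_eq_sum_div_card]
    rw [← Finset.sum_div, div_mul_eq_mul_div]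
    gcongr
  have h3 : 𝔼 τ : α → G, 𝔼 ε : α → ℤˣ, (⨆ p, ∑ a, ((ε a : ℤ) : ℝ) * |Φ p (x (a, τ a))|) ≤
      D / Fintype.card G * radAvg x := by
    refine le_trans (Finset.expect_le_expect fun τ _ => ?_) (expect_radMean_le hD0 hD x)
    refine (expect_ciSup_abs_le fun p a => Φ p (x (a, τ a))).trans ?_
    refine Finset.expect_le_expect fun ε _ => ciSup_le fun p => ?_
    rw [← map_signSum (Φ p) ε (fun a => x (a, τ a))]
    refine (le_abs_self _).trans ?_
    simpa using (Φ p).le_of_opNorm_le (hΦ1 p) (signSum ε (fun a => x (a, τ a)))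
  obtain ⟨τ, -, hτ⟩ := Finset.exists_le_of_expect_le Finset.univ_nonempty
    (h1.trans (add_le_add h2 (mul_le_mul_of_nonneg_left h3 zero_le_two)))
  refine ⟨τ, fun θ => ?_⟩
  calc ‖signSum θ (fun a => x (a, τ a))‖ = Φ (τ, θ) (signSum θ (fun a => x (a, τ a))) := by
        simpa using (hΦ2 (τ, θ)).symm
    _ ≤ ∑ a, |Φ (τ, θ) (x (a, τ a))| := by
        rw [map_signSum]
        refine Finset.sum_le_sum fun a _ => ?_
        rcases Int.units_eq_one_or (θ a) with h | h
        · simpa [h] using le_abs_self _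
        · simpa [h] using neg_le_abs _
    _ ≤ _ := Finite.le_ciSup (fun p => ∑ a, |Φ p (x (a, τ a))|) (τ, θ)
    _ ≤ _ := hτ
    _ = _ := by ring

end Selection

/-! ### Extremal families from the failure of cotype. -/

section Cotype

variable {X : Type*} [NormedAddCommGroup X] [NormedSpace ℝ X]

theorem radAvg_fin_eq {n : ℕ} (x : Fin n → X) :
    radAvg x = √((∑ ε : Fin n → ℤˣ, ‖∑ k, (ε k : ℤ) • x k‖ ^ 2) / 2 ^ n) := by
  simp [radAvg, Fintype.expect_eq_sum_div_card, signSum]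

theorem HasCotype.exists_forall_fintype {s : ℝ} (h : HasCotype X s) :
    ∃ K : ℝ, 0 ≤ K ∧ ∀ (ι : Type) [Fintype ι] [DecidableEq ι] (x : ι → X),
      (∑ k, ‖x k‖ ^ s) ^ (1 / s) ≤ K * radAvg x := by
  obtain ⟨K, hK, h⟩ := h
  refine ⟨K, hK, fun ι _ _ x => ?_⟩
  have e := Fintype.equivFin ι
  have h1 := h _ (x ∘ e.symm)
  rw [← radAvg_fin_eq] at h1
  calc (∑ k, ‖x k‖ ^ s) ^ (1 / s) = (∑ k, ‖(x ∘ e.symm) k‖ ^ s) ^ (1 / s) := by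
        congr 1
        exact Fintype.sum_equiv e _ _ fun k => by simp
    _ ≤ K * radAvg (x ∘ e.symm) := h1
    _ ≤ _ := by gcongr; exact radAvg_comp_le _ e.symm.injective x

/-- The hypothesis on the set of the j largest entries bounds the j-th largest by V j^(-β). The
induction removes the smallest entry. -/
theorem sum_rpow_le_of_card_rpow_le {ι : Type*} [DecidableEq ι] (a : ι → ℝ) {V β u : ℝ}
    (hu : 0 ≤ u) (S : Finset ι) (ha : ∀ k ∈ S, 0 ≤ a k)
    (h : ∀ T ⊆ S, ∀ t, 0 ≤ t → (∀ k ∈ T, t ≤ a k) → t * (T.card : ℝ) ^ β ≤ V) :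
    ∑ k ∈ S, a k ^ u ≤ V ^ u * ∑ j ∈ Finset.range S.card, ((j : ℝ) + 1) ^ (-(β * u)) := by
  have hV : 0 ≤ V := by simpa using h ∅ (by simp) 0 le_rfl (by simp)
  induction hn : S.card generalizing S with
  | zero => simp [Finset.card_eq_zero.1 hn]
  | succ n ih =>
    have hne : S.Nonempty := by rw [← Finset.card_pos]; omega
    obtain ⟨k, hk, hmin⟩ := Finset.exists_min_image S a hne
    have hcard : (S.erase k).card = n := by rw [Finset.card_erase_of_mem hk]; omega
    have h1 := ih (S.erase k) (fun l hl => ha l (Finset.mem_of_mem_erase hl))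
      (fun T hT => h T (hT.trans (Finset.erase_subset _ _))) hcard
    have h2 := h S subset_rfl (a k) (ha k hk) hmin
    rw [hn, Nat.cast_succ] at h2
    have hpos : (0 : ℝ) < (n : ℝ) + 1 := by positivity
    have h3 : a k ≤ V * ((n : ℝ) + 1) ^ (-β) := by
      rw [Real.rpow_neg hpos.le, ← div_eq_mul_inv, le_div_iff₀ (Real.rpow_pos_of_pos hpos _)]
      exact h2
    have h4 : a k ^ u ≤ V ^ u * ((n : ℝ) + 1) ^ (-(β * u)) := by
      calc a k ^ u ≤ (V * ((n : ℝ) + 1) ^ (-β)) ^ u := Real.rpow_le_rpow (ha k hk) h3 hu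
        _ = _ := by
          rw [Real.mul_rpow hV (Real.rpow_nonneg hpos.le _), ← Real.rpow_mul hpos.le, neg_mul]
    rw [← Finset.sum_erase_add _ _ hk, Finset.sum_range_succ, mul_add]
    exact add_le_add h1 h4

theorem summable_nat_add_one_rpow_neg {u : ℝ} (hu : 1 < u) :
    Summable fun j : ℕ => ((j : ℝ) + 1) ^ (-u) := by
  have := (summable_nat_add_iff 1).2 (Real.summable_nat_rpow (p := -u) |>.2 (by linarith))
  simpa using this

/-- If all families of vectors of large norm satisfy a lower estimate of exponent `p`, the space has
every larger cotype. -/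
theorem hasCotype_of_card_rpow_le {p p' : ℝ} (hp : 0 < p) (hpp : p < p') {c : ℝ} (hc : 0 ≤ c)
    (h : ∀ (n : ℕ) (x : Fin n → X) (T : Finset (Fin n)) (t : ℝ), 0 ≤ t → (∀ k ∈ T, t ≤ ‖x k‖) →
      t * (T.card : ℝ) ^ (1 / p) ≤ c * radAvg x) : HasCotype X p' := by
  have hp' : 0 < p' := hp.trans hpp
  set Z := ∑' j : ℕ, ((j : ℝ) + 1) ^ (-(1 / p * p')) with hZ
  have hZ0 : 0 ≤ Z := tsum_nonneg fun j => by positivity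
  have hs : Summable fun j : ℕ => ((j : ℝ) + 1) ^ (-(1 / p * p')) :=
    summable_nat_add_one_rpow_neg (by rw [one_div_mul_eq_div, one_lt_div hp]; exact hpp)
  refine ⟨c * Z ^ (1 / p'), by positivity, fun n x => ?_⟩
  rw [← radAvg_fin_eq]
  have hR := radAvg_nonneg x
  have h1 := sum_rpow_le_of_card_rpow_le (fun k => ‖x k‖) hp'.le Finset.univ
    (fun k _ => norm_nonneg _) (V := c * radAvg x) (β := 1 / p) (fun T _ t ht hT => h n x T t ht hT)
  have h2 : ∑ k, ‖x k‖ ^ p' ≤ (c * radAvg x) ^ p' * Z :=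
    h1.trans (by gcongr; exact hs.sum_le_tsum _ fun j _ => by positivity)
  calc (∑ k, ‖x k‖ ^ p') ^ (1 / p') ≤ ((c * radAvg x) ^ p' * Z) ^ (1 / p') :=
        Real.rpow_le_rpow (by positivity) h2 (by positivity)
    _ = _ := by
        rw [Real.mul_rpow (by positivity) hZ0, ← Real.rpow_mul (by positivity),
          mul_one_div_cancel hp'.ne', Real.rpow_one]
        ring

theorem exists_family_of_not_hasCotype {p p' : ℝ} (hp : 0 < p) (hpp : p < p')
    (h : ¬ HasCotype X p') {c : ℝ} (hc : 0 ≤ c) :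
    ∃ (n : ℕ) (x : Fin n → X) (T : Finset (Fin n)), (∀ k ∈ T, 1 ≤ ‖x k‖) ∧
      c * radAvg x < (T.card : ℝ) ^ (1 / p) := by
  by_contra! hcon
  refine h (hasCotype_of_card_rpow_le hp hpp hc fun n x T t ht hT => ?_)
  rcases ht.eq_or_lt with rfl | ht
  · rw [zero_mul]; exact mul_nonneg hc (radAvg_nonneg x)
  have h1 := hcon n (fun k => t⁻¹ • x k) T fun k hk => by
    rw [norm_smul, norm_inv, Real.norm_of_nonneg ht.le, inv_mul_eq_div, one_le_div ht]
    exact hT k hk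
  rw [radAvg_smul (inv_nonneg.2 ht.le)] at h1
  calc t * (T.card : ℝ) ^ (1 / p) ≤ t * (c * (t⁻¹ * radAvg x)) := by gcongr
    _ = _ := by field_simp

theorem exists_pow_le_lt_succ_pow (n L : ℕ) :
    ∃ m : ℕ, m ^ (L + 1) ≤ n ∧ n < (m + 1) ^ (L + 1) := by
  have hex : ∃ m : ℕ, n < (m + 1) ^ (L + 1) :=
    ⟨n, (Nat.lt_succ_self n).trans_le (Nat.le_self_pow (by omega) _)⟩
  classical
  refine ⟨Nat.find hex, ?_, Nat.find_spec hex⟩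
  rcases hm : Nat.find hex with _ | m
  · simp
  · exact not_lt.1 (Nat.find_min hex (m := m) (by omega))

/-- If `κ < 1 / 2` is the reciprocal of the optimal cotype, there are arbitrarily large families of
vectors of norm at least `1` all of whose signed sums have norm at most of order `m ^ (κ + η)`. -/
theorem exists_family_signSum_le {κ : ℝ} (hκ0 : 0 ≤ κ) (hκ : κ < 1 / 2)
    (hlow : ∀ ρ, κ < ρ → ∀ c : ℝ, 0 ≤ c → ∃ (n : ℕ) (x : Fin n → X) (T : Finset (Fin n)),
      (∀ k ∈ T, 1 ≤ ‖x k‖) ∧ c * radAvg x < (T.card : ℝ) ^ ρ)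
    (hup : ∀ η : ℝ, 0 < η → ∃ σ K : ℝ, κ - η ≤ σ ∧ σ ≤ κ ∧ 0 ≤ K ∧
      ∀ (G : Type) [Fintype G] [DecidableEq G] (y : G → X),
        ∑ i, ‖y i‖ ≤ K * (Fintype.card G : ℝ) ^ (1 - σ) * radAvg y)
    {η : ℝ} (hη : 0 < η) :
    ∃ C : ℝ, 0 < C ∧ ∀ m₀ : ℕ, ∃ m, m₀ < m ∧ ∃ x : Fin m → X, (∀ k, 1 ≤ ‖x k‖) ∧
      ∀ θ, ‖signSum θ x‖ ≤ C * (m : ℝ) ^ (κ + η) := by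
  -- This size of L gives m ≤ M^(1 - 2σ) for M = m^L, so √(mM) ≤ M^(1 - σ).
  obtain ⟨L, hL⟩ := exists_nat_gt (1 / (1 - 2 * κ))
  have hL1 : 1 ≤ (L : ℝ) * (1 - 2 * κ) := by
    rw [div_lt_iff₀ (by linarith)] at hL; exact hL.le
  -- The final exponent is at most (L + 1)(κ + η') - L(κ - η') = κ + (2L + 1)η'.
  obtain ⟨η', hη', hη'1, hη'2⟩ : ∃ η' : ℝ, 0 < η' ∧ η' ≤ 1 / 2 ∧ (2 * L + 1) * η' ≤ η := by
    refine ⟨min (1 / 2) (η / (2 * L + 1)), by positivity, min_le_left _ _, ?_⟩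
    calc (2 * L + 1) * min (1 / 2) (η / (2 * L + 1)) ≤ (2 * L + 1) * (η / (2 * L + 1)) := by
          gcongr; exact min_le_right _ _
      _ = η := by field_simp
  obtain ⟨σ, K, hσ1, hσ2, hK, hup⟩ := hup η' hη'
  set ρ := κ + η' with hρ
  refine ⟨(1 + 2 * K) * 2 ^ ((L + 1) * ρ), by positivity, fun m₀ => ?_⟩
  -- The average is at least 1 and ρ ≤ 1, so this constant forces |T| > (m₀ + 1)^(L + 1), hence m >
  -- m₀.
  obtain ⟨n, x, T, hT, hlt⟩ := hlow ρ (by linarith) (((m₀ + 1) ^ (L + 1) : ℕ) : ℝ) (by positivity)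
  have hc1 : (1 : ℝ) ≤ (((m₀ + 1) ^ (L + 1) : ℕ) : ℝ) := by
    exact_mod_cast Nat.one_le_pow _ _ (Nat.succ_pos _)
  have hRnn := radAvg_nonneg x
  have hTne : T.Nonempty := by
    rw [Finset.nonempty_iff_ne_empty]
    rintro rfl
    rw [Finset.card_empty, Nat.cast_zero, Real.zero_rpow (by linarith)] at hlt
    have : 0 ≤ (((m₀ + 1) ^ (L + 1) : ℕ) : ℝ) * radAvg x := by positivity
    linarith
  have hR1 : 1 ≤ radAvg x := by
    obtain ⟨k, hk⟩ := hTne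
    exact (hT k hk).trans (norm_le_radAvg x k)
  have hR2 : radAvg x ≤ (T.card : ℝ) ^ ρ := by nlinarith
  have hTcard : (m₀ + 1) ^ (L + 1) < T.card := by
    have h1 : (1 : ℝ) ≤ T.card := by exact_mod_cast hTne.card_pos
    have h2 : (T.card : ℝ) ^ ρ ≤ T.card := by
      simpa using Real.rpow_le_rpow_of_exponent_le h1 (show ρ ≤ 1 by linarith)
    have h3 : (((m₀ + 1) ^ (L + 1) : ℕ) : ℝ) < T.card := by nlinarith
    exact_mod_cast h3
  obtain ⟨m, hm1, hm2⟩ := exists_pow_le_lt_succ_pow T.card L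
  have hmm : m₀ < m := by
    by_contra! hle
    have : (m + 1) ^ (L + 1) ≤ (m₀ + 1) ^ (L + 1) := Nat.pow_le_pow_left (by omega) _
    omega
  refine ⟨m, hmm, ?_⟩
  have hm0 : 0 < m := by omega
  have hmR : (0 : ℝ) < m := by exact_mod_cast hm0
  have : NeZero (m ^ L) := ⟨by positivity⟩
  have hcard : Fintype.card (Fin m × ZMod (m ^ L)) ≤ Fintype.card T := by
    rw [Fintype.card_prod, Fintype.card_fin, ZMod.card, Fintype.card_coe]
    calc m * m ^ L = m ^ (L + 1) := by ring
      _ ≤ _ := hm1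
  obtain ⟨e⟩ := Function.Embedding.nonempty_of_card_le hcard
  set z : Fin m × ZMod (m ^ L) → X := x ∘ (fun p => (e p : Fin n)) with hz
  have hzR : radAvg z ≤ radAvg x :=
    radAvg_comp_le _ (Subtype.val_injective.comp e.injective) x
  obtain ⟨τ, hτ⟩ := exists_selection_signSum_le (by positivity) (hup (ZMod (m ^ L))) z
  refine ⟨fun a => z (a, τ a), fun a => hT _ (e (a, τ a)).2, fun θ => (hτ θ).trans ?_⟩
  rw [ZMod.card, Fintype.card_fin]
  set M : ℝ := ((m ^ L : ℕ) : ℝ) with hM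
  have hM0 : 0 < M := by rw [hM]; exact_mod_cast Nat.pow_pos hm0
  have hMm : M = (m : ℝ) ^ (L : ℝ) := by rw [hM, Real.rpow_natCast]; push_cast; rfl
  have hm1R : (1 : ℝ) ≤ m := by exact_mod_cast hm0
  have h1 : √(m * M) ≤ M ^ (1 - σ) := by
    rw [Real.sqrt_le_left (by positivity), ← Real.rpow_natCast, ← Real.rpow_mul hM0.le]
    have h2 : (m : ℝ) ≤ M ^ (1 - 2 * σ) := by
      rw [hMm, ← Real.rpow_mul hmR.le]
      have : 1 ≤ (L : ℝ) * (1 - 2 * σ) := hL1.trans (by gcongr)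
      simpa using Real.rpow_le_rpow_of_exponent_le hm1R this
    calc m * M ≤ M ^ (1 - 2 * σ) * M ^ (1 : ℝ) := by rw [Real.rpow_one]; gcongr
      _ = _ := by rw [← Real.rpow_add hM0]; congr 1; push_cast; ring
  have h2 : (√(m * M) + 2 * (K * M ^ (1 - σ))) / M ≤ (1 + 2 * K) * (m : ℝ) ^ (-(L * σ)) := by
    calc (√(m * M) + 2 * (K * M ^ (1 - σ))) / M
        ≤ (M ^ (1 - σ) + 2 * (K * M ^ (1 - σ))) / M := by gcongr
      _ = (1 + 2 * K) * (M ^ (1 - σ) / M ^ (1 : ℝ)) := by rw [Real.rpow_one]; ring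
      _ = _ := by
        rw [← Real.rpow_sub hM0, hMm, ← Real.rpow_mul hmR.le]
        congr 2; ring
  have h3 : radAvg x ≤ 2 ^ ((L + 1) * ρ) * (m : ℝ) ^ ((L + 1) * ρ) := by
    have hρ0 : 0 ≤ ρ := by linarith
    calc radAvg x ≤ (T.card : ℝ) ^ ρ := hR2
      _ ≤ ((2 * m : ℝ) ^ ((L : ℝ) + 1)) ^ ρ := by
        refine Real.rpow_le_rpow (by positivity) ?_ hρ0
        have : (T.card : ℝ) ≤ (((m + 1) ^ (L + 1) : ℕ) : ℝ) := by exact_mod_cast hm2.le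
        refine this.trans ?_
        have hcast : ((L : ℝ) + 1) = ((L + 1 : ℕ) : ℝ) := by push_cast; ring
        rw [hcast, Real.rpow_natCast]
        push_cast
        gcongr
        linarith
      _ = _ := by
        rw [← Real.rpow_mul (by positivity), Real.mul_rpow (by norm_num) hmR.le]
  calc _ ≤ ((1 + 2 * K) * (m : ℝ) ^ (-(L * σ))) * (2 ^ ((L + 1) * ρ) * (m : ℝ) ^ ((L + 1) * ρ)) := by
        apply mul_le_mul h2 (hzR.trans h3) (radAvg_nonneg _) (by positivity)
    _ = (1 + 2 * K) * 2 ^ ((L + 1) * ρ) * (m : ℝ) ^ (-(L * σ) + (L + 1) * ρ) := by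
        rw [Real.rpow_add hmR]; ring
    _ ≤ _ := by
        refine mul_le_mul_of_nonneg_left (Real.rpow_le_rpow_of_exponent_le hm1R ?_) (by positivity)
        have : (L : ℝ) * (κ - η') ≤ L * σ := by gcongr
        rw [hρ]
        linarith

end Cotype

/-! ### Exhaustion by disjoint blocks. -/

section Exhaustion

variable {X : Type*} [NormedAddCommGroup X] [NormedSpace ℝ X]

theorem radAvg_le_of_forall {ι : Type*} [Fintype ι] [DecidableEq ι] (x : ι → X) {W : ℝ}
    (hW : ∀ ε, ‖signSum ε x‖ ≤ W) : radAvg x ≤ W := by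
  have hW0 : 0 ≤ W := (norm_nonneg _).trans (hW 1)
  refine Real.sqrt_le_iff.2 ⟨hW0, Finset.expect_le Finset.univ_nonempty fun ε _ => ?_⟩
  exact pow_le_pow_left₀ (norm_nonneg _) (hW ε) 2

theorem abs_map_signSum_le {ι : Type*} [Fintype ι] (ε : ι → ℤˣ) (x : ι → X) (φ : X →L[ℝ] ℝ) :
    |φ (signSum ε x)| ≤ ∑ k, |φ (x k)| := by
  rw [map_signSum]
  refine (Finset.abs_sum_le_sum_abs _ _).trans (Finset.sum_le_sum fun k _ => ?_)
  rcases Int.units_eq_one_or (ε k) with h | h <;> simp [h]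

theorem norm_signSum_blocks_le {ι : Type*} [Fintype ι] [DecidableEq ι] (x : ι → X) {W : ℝ}
    (hW : ∀ ε, ‖signSum ε x‖ ≤ W) (𝓑 : Finset (Finset ι))
    (h𝓑 : (𝓑 : Set (Finset ι)).PairwiseDisjoint id) (θ : Finset ι → ι → ℤˣ) (ε : 𝓑 → ℤˣ) :
    ‖signSum ε (fun B : 𝓑 => ∑ k ∈ (B : Finset ι), (θ B k : ℤ) • x k)‖ ≤ W := by
  have hW0 : 0 ≤ W := (norm_nonneg _).trans (hW 1)
  obtain ⟨φ, hφ1, hφ2⟩ := exists_dual_vector'' ℝ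
    (signSum ε (fun B : 𝓑 => ∑ k ∈ (B : Finset ι), (θ B k : ℤ) • x k))
  calc _ = φ (signSum ε (fun B : 𝓑 => ∑ k ∈ (B : Finset ι), (θ B k : ℤ) • x k)) := by
        simpa using hφ2.symm
    _ ≤ ∑ B : 𝓑, |φ (∑ k ∈ (B : Finset ι), (θ B k : ℤ) • x k)| :=
        (le_abs_self _).trans (abs_map_signSum_le _ _ _)
    _ ≤ ∑ B : 𝓑, ∑ k ∈ (B : Finset ι), |φ (x k)| := by
        refine Finset.sum_le_sum fun B _ => ?_
        rw [map_sum]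
        refine (Finset.abs_sum_le_sum_abs _ _).trans (Finset.sum_le_sum fun k _ => ?_)
        rcases Int.units_eq_one_or (θ B k) with h | h <;> simp [h]
    _ = ∑ k ∈ 𝓑.biUnion id, |φ (x k)| := by
        rw [Finset.sum_biUnion h𝓑, Finset.sum_coe_sort 𝓑 (fun B => ∑ k ∈ B, |φ (x k)|)]
        rfl
    _ ≤ ∑ k, |φ (x k)| :=
        Finset.sum_le_sum_of_subset_of_nonneg (Finset.subset_univ _) fun _ _ _ => abs_nonneg _
    _ ≤ ‖φ‖ * W := sum_abs_le_of_signSum_le x hW φ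
    _ ≤ W := mul_le_of_le_one_left hW0 hφ1

/-- In a space of cotype `s`, after removing few vectors from a finite family with bounded signed
sums, the signed sums over all subsets are small. -/
theorem exists_finset_forall_disjoint {ι : Type} [Fintype ι] [DecidableEq ι] {s K : ℝ} (hs : 0 < s)
    (hK : ∀ (κ : Type) [Fintype κ] [DecidableEq κ] (y : κ → X),
      (∑ k, ‖y k‖ ^ s) ^ (1 / s) ≤ K * radAvg y) (hK0 : 0 ≤ K) (x : ι → X) {W : ℝ}
    (hW : ∀ ε, ‖signSum ε x‖ ≤ W) (l : ℝ) :
    ∃ D : Finset ι, l * D.card ≤ (K * W) ^ s ∧ ∀ B, Disjoint D B → ∀ θ : ι → ℤˣ,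
      ‖∑ k ∈ B, (θ k : ℤ) • x k‖ ^ s ≤ l * B.card := by
  classical
  choose θ hθ using fun B : Finset ι =>
    Finite.exists_max (fun θ : ι → ℤˣ => ‖∑ k ∈ B, (θ k : ℤ) • x k‖)
  set v : Finset ι → ℝ := fun B => ‖∑ k ∈ B, (θ B k : ℤ) • x k‖ with hv
  have hv0 : ∀ B, 0 ≤ v B := fun B => norm_nonneg _
  have hW0 : 0 ≤ W := (norm_nonneg _).trans (hW 1)
  have hsum : ∀ 𝓑 : Finset (Finset ι), (𝓑 : Set (Finset ι)).PairwiseDisjoint id →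
      ∑ B ∈ 𝓑, v B ^ s ≤ (K * W) ^ s := by
    intro 𝓑 h𝓑
    have h1 := (hK 𝓑 fun B => ∑ k ∈ (B : Finset ι), (θ B k : ℤ) • x k).trans
      (mul_le_mul_of_nonneg_left (radAvg_le_of_forall _ fun ε =>
        norm_signSum_blocks_le x hW 𝓑 h𝓑 θ ε) hK0)
    rw [Finset.sum_coe_sort 𝓑 (fun B => v B ^ s), one_div] at h1
    exact (Real.rpow_inv_le_iff_of_pos (Finset.sum_nonneg fun B _ => Real.rpow_nonneg (hv0 B) _)
      (by positivity) hs).1 h1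
  set F : Finset (Finset (Finset ι)) :=
    Finset.univ.filter fun 𝓑 => (𝓑 : Set (Finset ι)).PairwiseDisjoint id with hF
  have hFmem : ∀ 𝓑, 𝓑 ∈ F ↔ (𝓑 : Set (Finset ι)).PairwiseDisjoint id := fun 𝓑 => by simp [hF]
  have hFe : ∅ ∈ F := by simp [hFmem]
  -- The union of a maximizing disjoint family is removed. Comparison with the empty family bounds
  -- its size; comparison with the family enlarged by B gives the estimate on B.
  obtain ⟨𝓑, h𝓑F, hmax⟩ := Finset.exists_max_image F
    (fun 𝓑 => ∑ B ∈ 𝓑, (v B ^ s - l * B.card)) ⟨∅, hFe⟩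
  have h𝓑 := (hFmem 𝓑).1 h𝓑F
  refine ⟨𝓑.biUnion id, ?_, fun B hB θ' => ?_⟩
  · have h0 := hmax ∅ hFe
    rw [Finset.sum_empty, Finset.sum_sub_distrib, ← Finset.mul_sum] at h0
    rw [Finset.card_biUnion h𝓑]
    push_cast
    simp only [id]
    linarith [hsum 𝓑 h𝓑]
  · rcases B.eq_empty_or_nonempty with rfl | hne
    · simp [Real.zero_rpow hs.ne']
    have hdis : ∀ C ∈ 𝓑, Disjoint C B := fun C hC =>
      hB.mono_left (Finset.subset_biUnion_of_mem id hC)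
    have hnot : B ∉ 𝓑 := fun hmem => hne.ne_empty (disjoint_self.1 (hdis B hmem))
    have h1 := hmax (insert B 𝓑) ((hFmem _).2 (by
      rw [Finset.coe_insert]
      exact h𝓑.insert fun C hC _ => (hdis C hC).symm))
    rw [Finset.sum_insert hnot] at h1
    calc _ ≤ v B ^ s := Real.rpow_le_rpow (norm_nonneg _) (hθ B θ') hs.le
      _ ≤ _ := by linarith

end Exhaustion

/-! ### From signed sums to weak ℓ_r sums. -/

section WeaklySummableFamilies

theorem RCLike.norm_le_abs_re_add_abs_im {𝕜 : Type*} [RCLike 𝕜] (z : 𝕜) :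
    ‖z‖ ≤ |RCLike.re z| + |RCLike.im z| := by
  refine (sq_le_sq₀ (norm_nonneg _) (by positivity)).1 ?_
  rw [RCLike.norm_sq_eq_def]
  nlinarith [abs_mul_abs_self (RCLike.re z), abs_mul_abs_self (RCLike.im z),
    mul_nonneg (abs_nonneg (RCLike.re z)) (abs_nonneg (RCLike.im z))]

theorem sum_norm_map_le {𝕜 : Type*} [RCLike 𝕜] {X : Type*} [NormedAddCommGroup X]
    [NormedSpace 𝕜 X] {ι : Type*} (x : ι → X) (B : Finset ι) {W : ℝ}
    (hW : ∀ θ : ι → ℤˣ, ‖∑ k ∈ B, (θ k : ℤ) • x k‖ ≤ W) (φ : X →L[𝕜] 𝕜) :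
    ∑ k ∈ B, ‖φ (x k)‖ ≤ 2 * (‖φ‖ * W) := by
  have key : ∀ f : 𝕜 →+ ℝ, (∀ z, |f z| ≤ ‖z‖) → ∑ k ∈ B, |f (φ (x k))| ≤ ‖φ‖ * W := by
    intro f hf
    set θ : ι → ℤˣ := fun k => if 0 ≤ f (φ (x k)) then 1 else -1 with hθ
    calc ∑ k ∈ B, |f (φ (x k))| = f (φ (∑ k ∈ B, (θ k : ℤ) • x k)) := by
          rw [map_sum, map_sum]
          refine Finset.sum_congr rfl fun k _ => ?_
          rw [map_zsmul, map_zsmul, hθ]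
          dsimp only
          split_ifs with h
          · simp [abs_of_nonneg h]
          · simp [abs_of_neg (not_le.1 h)]
      _ ≤ ‖φ (∑ k ∈ B, (θ k : ℤ) • x k)‖ := (le_abs_self _).trans (hf _)
      _ ≤ ‖φ‖ * W := (φ.le_opNorm _).trans (by gcongr; exact hW θ)
  have h1 := key (RCLike.re : 𝕜 →+ ℝ) RCLike.abs_re_le_norm
  have h2 := key (RCLike.im : 𝕜 →+ ℝ) RCLike.abs_im_le_norm
  calc ∑ k ∈ B, ‖φ (x k)‖ ≤ ∑ k ∈ B, (|RCLike.re (φ (x k))| + |RCLike.im (φ (x k))|) :=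
        Finset.sum_le_sum fun k _ => RCLike.norm_le_abs_re_add_abs_im _
    _ ≤ _ := by rw [Finset.sum_add_distrib]; linarith

/-- Splitting off the summable factor (j + 1)^(-(1 + η)) costs only m^η and treats γ below, at and
slightly above 1 alike. -/
theorem sum_range_rpow_neg_le {η γ : ℝ} (hη : 0 < η) (hγ : γ ≤ 1 + η) {n m : ℕ} (hnm : n ≤ m) :
    ∑ j ∈ Finset.range n, ((j : ℝ) + 1) ^ (-γ) ≤
      (∑' j : ℕ, ((j : ℝ) + 1) ^ (-(1 + η))) * (m : ℝ) ^ (1 + η - γ) := by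
  have hs := summable_nat_add_one_rpow_neg (show 1 < 1 + η by linarith)
  calc ∑ j ∈ Finset.range n, ((j : ℝ) + 1) ^ (-γ)
      ≤ ∑ j ∈ Finset.range n, ((j : ℝ) + 1) ^ (-(1 + η)) * (m : ℝ) ^ (1 + η - γ) := by
        refine Finset.sum_le_sum fun j hj => ?_
        have hj' : ((j : ℝ) + 1) ≤ m := by
          exact_mod_cast (Nat.succ_le_of_lt (Finset.mem_range.1 hj)).trans hnm
        have h0 : (0 : ℝ) < (j : ℝ) + 1 := by positivity
        have : ((j : ℝ) + 1) ^ (-γ) = ((j : ℝ) + 1) ^ (-(1 + η)) * ((j : ℝ) + 1) ^ (1 + η - γ) := by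
          rw [← Real.rpow_add h0]; congr 1; ring
        rw [this]
        gcongr
    _ ≤ _ := by
        rw [← Finset.sum_mul]
        gcongr
        exact hs.sum_le_tsum _ fun j _ => by positivity

/-- If |φ(xₖ)| ≥ t on T, then t |T| ≤ 2 ‖φ‖ V |T|^(1 - β), the 2 coming from real and imaginary
parts. So the ordered values decay like j^(-β). -/
theorem sum_norm_map_rpow_le {𝕜 : Type*} [RCLike 𝕜] {X : Type*} [NormedAddCommGroup X]
    [NormedSpace 𝕜 X] {m : ℕ} (x : Fin m → X) (A : Finset (Fin m)) {β r η V : ℝ} (hr : 0 < r)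
    (hη : 0 < η) (hβ0 : 0 < β) (hβ : β * r ≤ 1 + η) (hV : 0 ≤ V)
    (hA : ∀ T ⊆ A, ∀ θ : Fin m → ℤˣ, ‖∑ k ∈ T, (θ k : ℤ) • x k‖ ≤ V * (T.card : ℝ) ^ (1 - β))
    (φ : X →L[𝕜] 𝕜) :
    ∑ k ∈ A, ‖φ (x k)‖ ^ r ≤ ((2 * V) ^ r * ∑' j : ℕ, ((j : ℝ) + 1) ^ (-(1 + η))) *
      (m : ℝ) ^ (1 + η - β * r) * ‖φ‖ ^ r := by
  have h := sum_rpow_le_of_card_rpow_le (fun k => ‖φ (x k)‖) (V := 2 * V * ‖φ‖) (β := β) hr.le A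
    (fun k _ => norm_nonneg _) (by
      intro T hT t ht hTt
      rcases T.eq_empty_or_nonempty with rfl | hne
      · rw [Finset.card_empty, Nat.cast_zero, Real.zero_rpow hβ0.ne', mul_zero]
        positivity
      have hc : (0 : ℝ) < T.card := by exact_mod_cast hne.card_pos
      have h1 := sum_norm_map_le x T (hA T hT) φ
      have h2 : t * T.card ≤ ∑ k ∈ T, ‖φ (x k)‖ := by
        rw [mul_comm, ← nsmul_eq_mul]
        exact Finset.card_nsmul_le_sum _ _ _ hTt
      have h3 : (T.card : ℝ) = (T.card : ℝ) ^ β * (T.card : ℝ) ^ (1 - β) := by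
        rw [← Real.rpow_add hc]; simp
      have h4 : (0 : ℝ) < (T.card : ℝ) ^ (1 - β) := Real.rpow_pos_of_pos hc _
      refine le_of_mul_le_mul_right ?_ h4
      calc t * (T.card : ℝ) ^ β * (T.card : ℝ) ^ (1 - β) = t * T.card := by
            rw [mul_assoc, ← h3]
        _ ≤ _ := h2.trans h1
        _ = _ := by ring)
  calc _ ≤ _ := h
    _ ≤ (2 * V * ‖φ‖) ^ r * ((∑' j : ℕ, ((j : ℝ) + 1) ^ (-(1 + η))) *
        (m : ℝ) ^ (1 + η - β * r)) := by
        gcongr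
        exact sum_range_rpow_neg_le hη hβ ((Finset.card_le_univ A).trans_eq (Fintype.card_fin m))
    _ = _ := by
        rw [Real.mul_rpow (by positivity) (norm_nonneg _)]
        ring

/-- Families all of whose subfamilies have small signed sums contain, for `r < 2`, families of
vectors of norm at least `1` with small weak `ℓ_r`-norm. -/
theorem exists_family_weak_of_signSum {𝕜 : Type*} [RCLike 𝕜] {X : Type*} [NormedAddCommGroup X]
    [NormedSpace 𝕜 X] {κ r : ℝ} (hκ : κ < 1 / 2) (hr : 0 < r) (hr2 : r < 2)
    (h : ∀ η : ℝ, 0 < η → ∃ β C : ℝ, 0 < β ∧ β * r ≤ 1 + η ∧ 0 < C ∧ ∀ m₀ : ℕ, ∃ m, m₀ < m ∧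
      ∃ (x : Fin m → X) (A : Finset (Fin m)), m ≤ 2 * A.card ∧ (∀ k, 1 ≤ ‖x k‖) ∧
      ∀ T ⊆ A, ∀ θ : Fin m → ℤˣ, ‖∑ k ∈ T, (θ k : ℤ) • x k‖ ≤
        C * (m : ℝ) ^ (κ + β - 1 + η) * (T.card : ℝ) ^ (1 - β))
    {ε : ℝ} (hε : 0 < ε) :
    ∃ (m : ℕ) (x : Fin m → X), 0 < m ∧ (∀ k, 1 ≤ ‖x k‖) ∧
      ∀ φ : X →L[𝕜] 𝕜, ∑ k, ‖φ (x k)‖ ^ r ≤ ε * (m : ℝ) ^ (1 - r / 2) * ‖φ‖ ^ r := by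
  -- The exponent of m below is 1 - r(1 - κ) + (r + 1)η. This η spends half of the gap r(1/2 - κ),
  -- leaving the factor m^(-g).
  set η : ℝ := r * (1 / 2 - κ) / (2 * (r + 1)) with hηdef
  have hκ' : 0 < 1 / 2 - κ := by linarith
  have hη : 0 < η := by positivity
  have hη2 : (r + 1) * η = r * (1 / 2 - κ) / 2 := by rw [hηdef]; field_simp
  set g : ℝ := r * (1 / 2 - κ) / 2 with hg
  have hg0 : 0 < g := by positivity
  obtain ⟨β, C, hβ0, hβ, hC, hfam⟩ := h η hη
  set Z : ℝ := ∑' j : ℕ, ((j : ℝ) + 1) ^ (-(1 + η)) with hZ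
  have hZ0 : 0 ≤ Z := tsum_nonneg fun j => by positivity
  have hlim : Filter.Tendsto (fun m : ℕ => (2 * C) ^ r * Z * (m : ℝ) ^ (-g)) Filter.atTop
      (nhds ((2 * C) ^ r * Z * 0)) :=
    ((tendsto_rpow_neg_atTop hg0).comp tendsto_natCast_atTop_atTop).const_mul _
  rw [mul_zero] at hlim
  obtain ⟨m₀, hm₀⟩ := Filter.eventually_atTop.1 (hlim.eventually_lt_const (half_pos hε))
  obtain ⟨m, hm, x, A, hAc, hx, hA⟩ := hfam m₀
  have hm0 : 0 < m := by omega
  have hmR : (0 : ℝ) < m := by exact_mod_cast hm0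
  refine ⟨A.card, fun k => x (A.equivFin.symm k), by omega, fun k => hx _, fun φ => ?_⟩
  have h1 : ∑ k, ‖φ (x (A.equivFin.symm k))‖ ^ r = ∑ k ∈ A, ‖φ (x k)‖ ^ r := by
    rw [← Finset.sum_coe_sort A (fun k => ‖φ (x k)‖ ^ r)]
    exact Fintype.sum_equiv A.equivFin.symm _ _ fun k => rfl
  rw [h1]
  refine (sum_norm_map_rpow_le x A hr hη hβ0 hβ (by positivity) hA φ).trans
    (mul_le_mul_of_nonneg_right ?_ (by positivity))
  have h2 : (m : ℝ) ^ (1 - r / 2) ≤ 2 * (A.card : ℝ) ^ (1 - r / 2) := by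
    have hAc' : (m : ℝ) ≤ 2 * A.card := by exact_mod_cast hAc
    calc (m : ℝ) ^ (1 - r / 2) ≤ (2 * A.card : ℝ) ^ (1 - r / 2) := by
          gcongr
          linarith
      _ = 2 ^ (1 - r / 2) * (A.card : ℝ) ^ (1 - r / 2) :=
          Real.mul_rpow (by norm_num) (by positivity)
      _ ≤ _ := by
          gcongr
          calc (2 : ℝ) ^ (1 - r / 2) ≤ 2 ^ (1 : ℝ) :=
                Real.rpow_le_rpow_of_exponent_le (by norm_num) (by linarith)
            _ = 2 := Real.rpow_one 2
  calc (2 * (C * (m : ℝ) ^ (κ + β - 1 + η))) ^ r * Z * (m : ℝ) ^ (1 + η - β * r)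
      = ((2 * C) ^ r * Z * (m : ℝ) ^ (-g)) * (m : ℝ) ^ (1 - r / 2) := by
        rw [← mul_assoc 2 C, Real.mul_rpow (by positivity) (by positivity),
          ← Real.rpow_mul hmR.le]
        have : (m : ℝ) ^ ((κ + β - 1 + η) * r) * (m : ℝ) ^ (1 + η - β * r) =
            (m : ℝ) ^ (-g) * (m : ℝ) ^ (1 - r / 2) := by
          rw [← Real.rpow_add hmR, ← Real.rpow_add hmR]
          congr 1
          linarith
        linear_combination ((2 * C) ^ r * Z) * this
    _ ≤ (ε / 2) * (2 * (A.card : ℝ) ^ (1 - r / 2)) := by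
        refine mul_le_mul (hm₀ m hm.le).le h2 (by positivity) (by positivity)
    _ = _ := by ring

end WeaklySummableFamilies

/-! ### Using the cotype index on both sides. -/

section CotypeIndex

/-- For r ≤ 1 the weak ℓ₁ bound suffices, with β = 1 and nothing removed. For r > 1 the exhaustion
argument gives β = 1 - 1/s. -/
theorem exists_subfamily_signSum {X : Type*} [NormedAddCommGroup X] [NormedSpace ℝ X] {κ r : ℝ}
    (hr2 : r < 2) (hrκ : r * (1 - κ) < 1)
    (hfam : ∀ η : ℝ, 0 < η → ∃ C : ℝ, 0 < C ∧ ∀ m₀ : ℕ, ∃ m, m₀ < m ∧ ∃ x : Fin m → X,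
      (∀ k, 1 ≤ ‖x k‖) ∧ ∀ θ, ‖signSum θ x‖ ≤ C * (m : ℝ) ^ (κ + η))
    (hcs : 0 < κ → ∀ η : ℝ, 0 < η → ∃ s : ℝ, 2 ≤ s ∧ κ - η ≤ 1 / s ∧ 1 / s ≤ κ ∧ HasCotype X s)
    {η : ℝ} (hη : 0 < η) :
    ∃ β C : ℝ, 0 < β ∧ β * r ≤ 1 + η ∧ 0 < C ∧ ∀ m₀ : ℕ, ∃ m, m₀ < m ∧
      ∃ (x : Fin m → X) (A : Finset (Fin m)), m ≤ 2 * A.card ∧ (∀ k, 1 ≤ ‖x k‖) ∧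
      ∀ T ⊆ A, ∀ θ : Fin m → ℤˣ, ‖∑ k ∈ T, (θ k : ℤ) • x k‖ ≤
        C * (m : ℝ) ^ (κ + β - 1 + η) * (T.card : ℝ) ^ (1 - β) := by
  rcases le_or_gt r 1 with hr1 | hr1
  · obtain ⟨C, hC, hfam⟩ := hfam η hη
    refine ⟨1, C, one_pos, by linarith, hC, fun m₀ => ?_⟩
    obtain ⟨m, hm, x, hx, hW⟩ := hfam m₀
    refine ⟨m, hm, x, Finset.univ, by simp; omega, hx, fun T _ θ => ?_⟩
    have := norm_signSum_comp_le (fun k : T => (k : Fin m)) Subtype.val_injective x hW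
      (θ ∘ fun k : T => (k : Fin m))
    rw [sub_self, Real.rpow_zero, mul_one, add_sub_cancel_right,
      ← Finset.sum_coe_sort T (fun k => (θ k : ℤ) • x k)]
    exact this
  · have hκ : 0 < κ := by
      by_contra! h
      nlinarith
    obtain ⟨s, hs2, hs1, hsκ, hs⟩ := hcs hκ (η / 2) (half_pos hη)
    have hs0 : 0 < s := by linarith
    obtain ⟨K, hK0, hK⟩ := hs.exists_forall_fintype
    have hK' : ∀ (ι : Type) [Fintype ι] [DecidableEq ι] (y : ι → X),
        (∑ k, ‖y k‖ ^ s) ^ (1 / s) ≤ (K + 1) * radAvg y := fun ι _ _ y =>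
      (hK ι y).trans (mul_le_mul_of_nonneg_right (by linarith) (radAvg_nonneg y))
    obtain ⟨C, hC, hfam⟩ := hfam η hη
    have hs12 : 1 / s ≤ 1 / 2 := one_div_le_one_div_of_le (by norm_num) hs2
    refine ⟨1 - 1 / s, 2 ^ (1 / s) * ((K + 1) * C), by linarith, by nlinarith, by positivity,
      fun m₀ => ?_⟩
    obtain ⟨m, hm, x, hx, hW⟩ := hfam m₀
    have hm0 : (0 : ℝ) < m := by exact_mod_cast (Nat.zero_le _).trans_lt hm
    set W : ℝ := C * (m : ℝ) ^ (κ + η) with hWdef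
    have hKW : 0 < (K + 1) * W := by positivity
    -- Chosen so that at most m/2 indices are removed; K + 1 in place of K keeps it positive.
    set l : ℝ := 2 * ((K + 1) * W) ^ s / m with hl
    have hl0 : 0 < l := by positivity
    obtain ⟨D, hD, hdis⟩ := exists_finset_forall_disjoint hs0 hK' (by linarith) x hW l
    refine ⟨m, hm, x, Dᶜ, ?_, hx, fun T hT θ => ?_⟩
    · have h1 : (2 : ℝ) * D.card ≤ m := by
        have h2 : 0 < ((K + 1) * W) ^ s := by positivity
        rw [hl, div_mul_eq_mul_div, div_le_iff₀ hm0] at hD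
        refine le_of_mul_le_mul_left ?_ h2
        linarith
      have h2 : 2 * D.card ≤ m := by exact_mod_cast h1
      rw [Finset.card_compl, Fintype.card_fin]
      omega
    · have h1 := hdis T (Finset.subset_compl_iff_disjoint_left.1 hT) θ
      have h2 : ‖∑ k ∈ T, (θ k : ℤ) • x k‖ ≤ (l * T.card) ^ (1 / s) := by
        rw [one_div]
        exact (Real.le_rpow_inv_iff_of_pos (norm_nonneg _) (by positivity) hs0).2 h1
      refine h2.trans (le_of_eq ?_)
      rw [Real.mul_rpow hl0.le (by positivity), sub_sub_cancel, hl,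
        Real.div_rpow (by positivity) hm0.le, Real.mul_rpow (by norm_num) (by positivity),
        ← Real.rpow_mul hKW.le, mul_one_div_cancel hs0.ne', Real.rpow_one, hWdef]
      have h3 : (m : ℝ) ^ (κ + (1 - 1 / s) - 1 + η) = (m : ℝ) ^ (κ + η) / (m : ℝ) ^ (1 / s) := by
        rw [← Real.rpow_sub hm0]; congr 1; ring
      rw [h3]
      ring

variable {X : Type*} [NormedAddCommGroup X]

theorem not_hasCotype_of_lt_cot {p : ℝ} (hp2 : 2 ≤ p) (hp : ENNReal.ofReal p < cot X) :
    ¬ HasCotype X p := fun h =>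
  hp.not_ge (iInf₂_le p ⟨hp2, h⟩)

theorem exists_hasCotype_of_cot_lt {b : ℝ} (hb : cot X < ENNReal.ofReal b) :
    ∃ s : ℝ, 2 ≤ s ∧ HasCotype X s ∧ cot X ≤ ENNReal.ofReal s ∧ s < b := by
  rw [cot] at hb
  simp only [iInf_lt_iff] at hb
  obtain ⟨s, hs, hsb⟩ := hb
  exact ⟨s, hs.1, hs.2, iInf₂_le s hs, (ENNReal.ofReal_lt_ofReal_iff_of_nonneg
    (by linarith [hs.1])).1 hsb⟩

theorem exists_hasCotype_inv_near (hκ : 0 < ((cot X)⁻¹).toReal) {η : ℝ} (hη : 0 < η) :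
    ∃ s : ℝ, 2 ≤ s ∧ ((cot X)⁻¹).toReal - η ≤ 1 / s ∧ 1 / s ≤ ((cot X)⁻¹).toReal ∧
      HasCotype X s := by
  set κ := ((cot X)⁻¹).toReal with hκdef
  -- The minimum with κ / 2 keeps the denominator positive.
  set b : ℝ := 1 / (κ - min η (κ / 2)) with hb
  have hmin : 0 < min η (κ / 2) := lt_min hη (half_pos hκ)
  have hmin2 : min η (κ / 2) ≤ κ / 2 := min_le_right _ _
  have hq : (cot X).toReal = 1 / κ := by rw [hκdef, ENNReal.toReal_inv]; simp
  have hqtop : cot X ≠ ⊤ := by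
    intro h
    rw [hκdef, h] at hκ
    simp at hκ
  have hlt : cot X < ENNReal.ofReal b := by
    rw [ENNReal.lt_ofReal_iff_toReal_lt hqtop, hq, hb]
    exact one_div_lt_one_div_of_lt (by linarith) (by linarith)
  obtain ⟨s, hs2, hs, hqs, hsb⟩ := exists_hasCotype_of_cot_lt hlt
  have hs0 : 0 < s := by linarith
  refine ⟨s, hs2, ?_, ?_, hs⟩
  · have h1 : 1 / b ≤ 1 / s := one_div_le_one_div_of_le hs0 hsb.le
    rw [hb, one_div_one_div] at h1
    linarith [min_le_left η (κ / 2)]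
  · rw [one_div_le hs0 hκ, ← hq]
    exact ENNReal.toReal_le_of_le_ofReal hs0.le hqs

variable [NormedSpace ℝ X]

theorem sum_norm_le_card_rpow_mul_radAvg {s K : ℝ} (hs : 2 ≤ s)
    (hK : ∀ (ι : Type) [Fintype ι] [DecidableEq ι] (x : ι → X),
      (∑ k, ‖x k‖ ^ s) ^ (1 / s) ≤ K * radAvg x)
    (G : Type) [Fintype G] [DecidableEq G] (y : G → X) :
    ∑ i, ‖y i‖ ≤ K * (Fintype.card G : ℝ) ^ (1 - 1 / s) * radAvg y := by
  have hs0 : 0 < s := by linarith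
  have h1 := Real.rpow_sum_le_const_mul_sum_rpow (Finset.univ : Finset G) (fun i => ‖y i‖)
    (show 1 ≤ s by linarith)
  simp only [abs_norm, Finset.card_univ] at h1
  have h0 : 0 ≤ ∑ i, ‖y i‖ := by positivity
  have h2 := Real.rpow_le_rpow (by positivity) h1 (show 0 ≤ 1 / s by positivity)
  rw [← Real.rpow_mul h0, mul_one_div_cancel hs0.ne', Real.rpow_one,
    Real.mul_rpow (by positivity) (by positivity), ← Real.rpow_mul (by positivity)] at h2
  have h3 : (s - 1) * (1 / s) = 1 - 1 / s := by field_simp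
  rw [h3] at h2
  calc _ ≤ _ := h2
    _ ≤ (Fintype.card G : ℝ) ^ (1 - 1 / s) * (K * radAvg y) := by gcongr; exact hK G y
    _ = _ := by ring

theorem exists_family_of_cot_inv_lt {ρ : ℝ} (hq : 2 < cot X) (hρ : ((cot X)⁻¹).toReal < ρ) {c : ℝ}
    (hc : 0 ≤ c) : ∃ (n : ℕ) (x : Fin n → X) (T : Finset (Fin n)),
      (∀ k ∈ T, 1 ≤ ‖x k‖) ∧ c * radAvg x < (T.card : ℝ) ^ ρ := by
  have hρ0 : 0 < ρ := ENNReal.toReal_nonneg.trans_lt hρ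
  set p : ℝ := max 2 (1 / ρ) with hp
  have hp2 : 2 ≤ p := le_max_left _ _
  have hlt : ENNReal.ofReal p < cot X := by
    rw [hp, ENNReal.ofReal_max, max_lt_iff]
    refine ⟨by simpa using hq, ?_⟩
    rcases eq_or_ne (cot X) ⊤ with h | h
    · rw [h]; exact ENNReal.ofReal_lt_top
    · rw [ENNReal.ofReal_lt_iff_lt_toReal (by positivity) h]
      have h1 : 0 < (cot X).toReal :=
        ENNReal.toReal_pos ((zero_lt_two).trans hq).ne' h
      rw [ENNReal.toReal_inv] at hρ
      rw [one_div_lt hρ0 h1, one_div]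
      exact hρ
  obtain ⟨p', hp1, hp'⟩ := ENNReal.lt_iff_exists_nnreal_btwn.1 hlt
  have hpp : p < p' := by
    rw [← ENNReal.ofReal_coe_nnreal] at hp1
    exact (ENNReal.ofReal_lt_ofReal_iff_of_nonneg (by linarith)).1 hp1
  have hnot : ¬ HasCotype X (p' : ℝ) :=
    not_hasCotype_of_lt_cot (by linarith) (by rwa [ENNReal.ofReal_coe_nnreal])
  obtain ⟨n, x, T, hT, hlt⟩ := exists_family_of_not_hasCotype (by linarith) hpp hnot hc
  refine ⟨n, x, T, hT, hlt.trans_le ?_⟩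
  have hpρ : 1 / p ≤ ρ := by
    rw [one_div_le (by linarith) hρ0]; exact le_max_right _ _
  rcases T.eq_empty_or_nonempty with rfl | hne
  · rw [Finset.card_empty, Nat.cast_zero, Real.zero_rpow (by positivity), Real.zero_rpow hρ0.ne']
  · exact Real.rpow_le_rpow_of_exponent_le (by exact_mod_cast hne.card_pos) hpρ

theorem exists_sum_norm_le (η : ℝ) (hη : 0 < η) :
    ∃ σ K : ℝ, ((cot X)⁻¹).toReal - η ≤ σ ∧ σ ≤ ((cot X)⁻¹).toReal ∧ 0 ≤ K ∧
      ∀ (G : Type) [Fintype G] [DecidableEq G] (y : G → X),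
        ∑ i, ‖y i‖ ≤ K * (Fintype.card G : ℝ) ^ (1 - σ) * radAvg y := by
  rcases (ENNReal.toReal_nonneg (a := (cot X)⁻¹)).eq_or_lt with h0 | hpos
  · refine ⟨0, 1, by linarith, h0.le, zero_le_one, fun G _ _ y => ?_⟩
    rw [sub_zero, Real.rpow_one, one_mul, ← nsmul_eq_mul]
    exact Finset.sum_le_card_nsmul _ _ _ fun i _ => norm_le_radAvg y i
  · obtain ⟨s, hs2, hs1, hsκ, hs⟩ := exists_hasCotype_inv_near hpos hη
    obtain ⟨K, hK0, hK⟩ := hs.exists_forall_fintype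
    exact ⟨1 / s, K, hs1, hsκ, hK0, sum_norm_le_card_rpow_mul_radAvg hs2 hK⟩

end CotypeIndex

/-- If `cot X = q > 2` and `r < q*`, there are finite families of vectors of norm at least `1` whose
weak `ℓ_r`-norm is small compared with `m ^ (1 / r - 1 / 2)`. -/
theorem exists_family_weak {𝕜 : Type*} [RCLike 𝕜] {X : Type*} [NormedAddCommGroup X]
    [NormedSpace 𝕜 X] (hq : 2 < cot X) {r : ℝ} (hr : 0 < r)
    (hrκ : r * (1 - ((cot X)⁻¹).toReal) < 1) {ε : ℝ} (hε : 0 < ε) :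
    ∃ (m : ℕ) (x : Fin m → X), 0 < m ∧ (∀ k, 1 ≤ ‖x k‖) ∧
      ∀ φ : X →L[𝕜] 𝕜, ∑ k, ‖φ (x k)‖ ^ r ≤ ε * (m : ℝ) ^ (1 - r / 2) * ‖φ‖ ^ r := by
  -- Cotype and signed sums involve only addition and the norm, so real functionals may be used up
  -- to this point.
  let _ : NormedSpace ℝ X := NormedSpace.restrictScalars ℝ 𝕜 X
  have hκ0 : 0 ≤ ((cot X)⁻¹).toReal := ENNReal.toReal_nonneg
  have hκ : ((cot X)⁻¹).toReal < 1 / 2 := by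
    have h1 : (cot X)⁻¹ < 2⁻¹ := ENNReal.inv_lt_inv.2 hq
    have h2 := (ENNReal.toReal_lt_toReal (h1.ne_top) (by simp)).2 h1
    simpa using h2
  have hr2 : r < 2 := by nlinarith
  refine exists_family_weak_of_signSum hκ hr hr2 (fun η hη => ?_) hε
  exact exists_subfamily_signSum hr2 hrκ
    (fun η hη => exists_family_signSum_le hκ0 hκ
      (fun ρ hρ c hc => exists_family_of_cot_inv_lt hq hρ hc) exists_sum_norm_le hη)
    (fun hpos η hη => exists_hasCotype_inv_near hpos hη) hη

/-! ### Baire category and random quadratic forms. -/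

section DominatedPolynomials

variable {𝕜 : Type*} [RCLike 𝕜] {X : Type*} [NormedAddCommGroup X] [NormedSpace 𝕜 X]

/-- The bilinear form `(x, y) ↦ φ x * φ y`. -/
noncomputable def squareForm (φ : X →L[𝕜] 𝕜) : ContinuousMultilinearMap 𝕜 (fun _ : Fin 2 => X) 𝕜 :=
  (ContinuousMultilinearMap.mkPiAlgebra 𝕜 (Fin 2) 𝕜).compContinuousLinearMap fun _ => φ

theorem squareForm_apply (φ : X →L[𝕜] 𝕜) (x : X) : squareForm φ (fun _ => x) = φ x ^ 2 := by
  simp [squareForm]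

theorem norm_squareForm_le (φ : X →L[𝕜] 𝕜) (hφ : ‖φ‖ ≤ 1) : ‖squareForm φ‖ ≤ 1 := by
  refine (ContinuousMultilinearMap.norm_compContinuousLinearMap_le _ _).trans ?_
  rw [ContinuousMultilinearMap.norm_mkPiAlgebra, one_mul]
  exact Finset.prod_le_one (fun _ _ => norm_nonneg _) fun _ _ => hφ

/-- The bilinear form `m⁻¹ ∑ εₖ φₖ ⊗ φₖ`. -/
noncomputable def signedForm {m : ℕ} (φ : Fin m → X →L[𝕜] 𝕜) (ε : Fin m → ℤˣ) :
    ContinuousMultilinearMap 𝕜 (fun _ : Fin 2 => X) 𝕜 :=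
  (m : 𝕜)⁻¹ • ∑ k, ((ε k : ℤ) : 𝕜) • squareForm (φ k)

theorem norm_intUnits_cast (u : ℤˣ) : ‖((u : ℤ) : 𝕜)‖ = 1 := by
  rcases Int.units_eq_one_or u with h | h <;> simp [h]

theorem norm_signedForm_le {m : ℕ} (hm : 0 < m) (φ : Fin m → X →L[𝕜] 𝕜) (hφ : ∀ k, ‖φ k‖ ≤ 1)
    (ε : Fin m → ℤˣ) : ‖signedForm φ ε‖ ≤ 1 := by
  have hmR : (0 : ℝ) < m := by exact_mod_cast hm
  have h : ‖∑ k, ((ε k : ℤ) : 𝕜) • squareForm (φ k)‖ ≤ m := by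
    refine (norm_sum_le _ _).trans ?_
    calc _ ≤ ∑ _k : Fin m, (1 : ℝ) := Finset.sum_le_sum fun k _ => by
          rw [norm_smul, norm_intUnits_cast, one_mul]; exact norm_squareForm_le _ (hφ k)
      _ = m := by simp
  rw [signedForm, norm_smul, norm_inv, RCLike.norm_natCast, inv_mul_le_iff₀ hmR, mul_one]
  exact h

theorem signedForm_apply {m : ℕ} (φ : Fin m → X →L[𝕜] 𝕜) (ε : Fin m → ℤˣ) (x : X) :
    signedForm φ ε (fun _ => x) = (m : 𝕜)⁻¹ * ∑ k, ((ε k : ℤ) : 𝕜) * φ k x ^ 2 := by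
  simp [signedForm, squareForm_apply]

/-- Flipping the k-th sign changes the value by 2 φₖ(x)² / m in modulus, so the two values have
moduli summing to at least 1/m; t ↦ t^ρ is subadditive. -/
theorem le_expect_norm_signedForm {m : ℕ} (φ : Fin m → X →L[𝕜] 𝕜) {ρ : ℝ}
    (hρ0 : 0 < ρ) (hρ1 : ρ ≤ 1) (x : X) (k : Fin m) (hx : 1 ≤ ‖φ k x‖) :
    (1 / 2) * ((m : ℝ)⁻¹) ^ ρ ≤ 𝔼 ε, ‖signedForm φ ε (fun _ => x)‖ ^ ρ := by
  rw [expect_eq_expect_half_add_flip _ k]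
  refine Finset.le_expect Finset.univ_nonempty fun ε _ => mul_le_mul_of_nonneg_left ?_ (by norm_num)
  set a := signedForm φ ε (fun _ => x) with ha
  set b := signedForm φ (ε * Pi.mulSingle k (-1)) (fun _ => x) with hb
  have hab : a - b = (m : 𝕜)⁻¹ * (2 * ((ε k : ℤ) : 𝕜) * φ k x ^ 2) := by
    rw [ha, hb, signedForm_apply, signedForm_apply, ← mul_sub, ← Finset.sum_sub_distrib]
    congr 1
    rw [Finset.sum_eq_single k]
    · simp; ring
    · intro l _ hl
      simp [Pi.mulSingle_eq_of_ne hl]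
    · simp
  have hnorm : (m : ℝ)⁻¹ ≤ ‖a‖ + ‖b‖ := by
    refine le_trans ?_ (norm_sub_le a b)
    rw [hab, norm_mul, norm_mul, norm_mul, norm_inv, RCLike.norm_natCast, norm_intUnits_cast,
      norm_pow, RCLike.norm_ofNat]
    have : 1 ≤ ‖φ k x‖ ^ 2 := one_le_pow₀ hx
    have hm : (0 : ℝ) ≤ (m : ℝ)⁻¹ := by positivity
    nlinarith
  exact (Real.rpow_le_rpow (by positivity) hnorm hρ0.le).trans
    (Real.rpow_add_le_add_rpow (norm_nonneg _) (norm_nonneg _) hρ0.le hρ1)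

/-- Uniform boundedness by Baire: some closed set of forms with bounded sums contains a ball, and
subadditivity of t^ρ moves that ball to the origin. -/
theorem exists_forall_sum_le_of_summable (y : ℕ → X) {ρ : ℝ} (hρ0 : 0 < ρ) (hρ1 : ρ ≤ 1)
    (h : ∀ A : ContinuousMultilinearMap 𝕜 (fun _ : Fin 2 => X) 𝕜,
      Summable fun j => ‖A fun _ => y j‖ ^ ρ) :
    ∃ C : ℝ, ∀ A : ContinuousMultilinearMap 𝕜 (fun _ : Fin 2 => X) 𝕜, ‖A‖ ≤ 1 →
      ∀ s : Finset ℕ, ∑ j ∈ s, ‖A fun _ => y j‖ ^ ρ ≤ C := by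
  set F : ℕ → Set (ContinuousMultilinearMap 𝕜 (fun _ : Fin 2 => X) 𝕜) := fun n =>
    ⋂ s : Finset ℕ, {A | ∑ j ∈ s, ‖A fun _ => y j‖ ^ ρ ≤ n} with hF
  have hclosed : ∀ n, IsClosed (F n) := fun n => isClosed_iInter fun s => by
    refine isClosed_le (continuous_finsetSum _ fun j _ => ?_) continuous_const
    refine Continuous.rpow_const ?_ fun _ => Or.inr hρ0.le
    exact (ContinuousMultilinearMap.apply 𝕜 (fun _ : Fin 2 => X) 𝕜 (fun _ => y j)).continuous.norm
  have hunion : ⋃ n, F n = Set.univ := by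
    refine Set.eq_univ_of_forall fun A => ?_
    obtain ⟨n, hn⟩ := exists_nat_ge (∑' j, ‖A fun _ => y j‖ ^ ρ)
    refine Set.mem_iUnion.2 ⟨n, Set.mem_iInter.2 fun s => ?_⟩
    exact ((h A).sum_le_tsum s fun j _ => by positivity).trans hn
  obtain ⟨n, A₀, hA₀⟩ := nonempty_interior_of_iUnion_of_closed hclosed hunion
  obtain ⟨δ, hδ, hball⟩ := Metric.mem_nhds_iff.1 (mem_interior_iff_mem_nhds.1 hA₀)
  refine ⟨(n + n) / (δ / 2) ^ ρ, fun A hA s => ?_⟩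
  have hmem : ∀ B ∈ F n, ∑ j ∈ s, ‖B fun _ => y j‖ ^ ρ ≤ n := fun B hB => Set.mem_iInter.1 hB s
  have h0 := hmem A₀ (hball (Metric.mem_ball_self hδ))
  have h1 := hmem (A₀ + ((δ / 2 : ℝ) : 𝕜) • A) (hball (by
    rw [mem_ball_iff_norm, add_sub_cancel_left, norm_smul, RCLike.norm_ofReal,
      abs_of_pos (by positivity)]
    nlinarith))
  rw [le_div_iff₀ (by positivity), Finset.sum_mul]
  refine le_trans ?_ (add_le_add h1 h0)
  rw [← Finset.sum_add_distrib]
  refine Finset.sum_le_sum fun j _ => ?_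
  rw [← Real.mul_rpow (norm_nonneg _) (by positivity)]
  refine le_trans (Real.rpow_le_rpow (by positivity) ?_ hρ0.le)
    (Real.rpow_add_le_add_rpow (norm_nonneg _) (norm_nonneg _) hρ0.le hρ1)
  refine le_trans (le_of_eq ?_) (norm_sub_le _ _)
  rw [add_apply, smul_apply, add_sub_cancel_left,
    norm_smul, RCLike.norm_ofReal, abs_of_pos (by positivity : (0 : ℝ) < δ / 2), mul_comm]

theorem weaklySummable_of_blocks {r : ℝ} {m : ℕ → ℕ} (x : ∀ N, Fin (m N) → X)
    (w α : ℕ → ℝ) (hα : ∀ N, 0 ≤ α N) (hw : Summable fun N => α N ^ r * w N)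
    (hx : ∀ N, ∀ φ : X →L[𝕜] 𝕜, ∑ k, ‖φ (x N k)‖ ^ r ≤ w N * ‖φ‖ ^ r)
    (e : ℕ ≃ Σ N, Fin (m N)) :
    WeaklySummable 𝕜 r fun j => (α (e j).1 : 𝕜) • x (e j).1 (e j).2 := by
  intro φ
  refine (Equiv.summable_iff e (f := fun p : Σ N, Fin (m N) =>
    ‖φ ((α p.1 : 𝕜) • x p.1 p.2)‖ ^ r)).2 ?_
  have hnorm : ∀ N k, ‖φ ((α N : 𝕜) • x N k)‖ ^ r = α N ^ r * ‖φ (x N k)‖ ^ r := by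
    intro N k
    rw [map_smul, norm_smul, RCLike.norm_ofReal, abs_of_nonneg (hα N),
      Real.mul_rpow (hα N) (norm_nonneg _)]
  refine (summable_sigma_of_nonneg fun p => by positivity).2 ⟨fun N => Summable.of_finite, ?_⟩
  refine Summable.of_nonneg_of_le (fun N => tsum_nonneg fun k => by positivity) (fun N => ?_)
    (hw.mul_right (‖φ‖ ^ r))
  rw [tsum_fintype]
  simp only [hnorm]
  rw [← Finset.mul_sum, mul_assoc]
  exact mul_le_mul_of_nonneg_left (hx N φ) (Real.rpow_nonneg (hα N) r)

/-- If there are finite families of vectors of norm at least `1` whose weak `ℓ_r`-norms are small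
compared with `m ^ (1 / r - 1 / 2)`, some `2`-homogeneous polynomial is not `r`-dominated. -/
theorem dominatedHomPoly_ne_of_families {r : ℝ} (hr : 0 < r) (hr2 : r < 2)
    (hfam : ∀ ε : ℝ, 0 < ε → ∃ (m : ℕ) (x : Fin m → X), 0 < m ∧ (∀ k, 1 ≤ ‖x k‖) ∧
      ∀ φ : X →L[𝕜] 𝕜, ∑ k, ‖φ (x k)‖ ^ r ≤ ε * (m : ℝ) ^ (1 - r / 2) * ‖φ‖ ^ r) :
    dominatedHomPoly 𝕜 r 2 X ≠ contHomPoly 𝕜 2 X := by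
  intro heq
  choose m x hm hx hφ using fun N : ℕ => hfam ((1 / 4 : ℝ) ^ N) (by positivity)
  have hmR : ∀ N, (0 : ℝ) < m N := fun N => by exact_mod_cast hm N
  -- With weak constants 4^(-N), this scaling makes the N-th block contribute at most 2^(-N) ‖φ‖^r
  -- to the weak sums, but on average at least 2^N / 2 to the sums for the random forms.
  set α : ℕ → ℝ := fun N => (2 ^ N / (m N : ℝ) ^ (1 - r / 2)) ^ (1 / r) with hα
  have hα0 : ∀ N, 0 ≤ α N := fun N => by positivity
  have hαr : ∀ N, α N ^ r = 2 ^ N / (m N : ℝ) ^ (1 - r / 2) := fun N => by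
    rw [hα, ← Real.rpow_mul (by positivity), one_div_mul_cancel hr.ne', Real.rpow_one]
  have : Infinite (Σ N, Fin (m N)) :=
    Infinite.of_injective (fun N => (⟨N, ⟨0, hm N⟩⟩ : Σ N, Fin (m N)))
      fun a b h => (Sigma.mk.inj_iff.1 h).1
  obtain ⟨hden⟩ := nonempty_denumerable (Σ N, Fin (m N))
  set e : ℕ ≃ Σ N, Fin (m N) := (Denumerable.eqv _).symm
  set y : ℕ → X := fun j => (α (e j).1 : 𝕜) • x (e j).1 (e j).2 with hy
  have hws : WeaklySummable 𝕜 r y := by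
    refine weaklySummable_of_blocks x (fun N => (1 / 4 : ℝ) ^ N * (m N : ℝ) ^ (1 - r / 2)) α hα0
      ?_ hφ e
    have : (fun N => α N ^ r * ((1 / 4 : ℝ) ^ N * (m N : ℝ) ^ (1 - r / 2))) =
        fun N => (1 / 2 : ℝ) ^ N := by
      funext N
      have h1 : (m N : ℝ) ^ (1 - r / 2) ≠ 0 := (Real.rpow_pos_of_pos (hmR N) _).ne'
      rw [hαr, mul_comm ((1 / 4 : ℝ) ^ N), ← mul_assoc, div_mul_cancel₀ _ h1, ← mul_pow]
      norm_num
    rw [this]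
    exact summable_geometric_two
  have hρ0 : 0 < r / 2 := by positivity
  have hρ1 : r / 2 ≤ 1 := by linarith
  obtain ⟨C, hC⟩ := exists_forall_sum_le_of_summable (𝕜 := 𝕜) y hρ0 hρ1 fun A => by
    have hA : (fun x => A fun _ => x) ∈ dominatedHomPoly 𝕜 r 2 X := by
      rw [heq]; exact ⟨A, fun _ => rfl⟩
    simpa using hA.2 y hws
  obtain ⟨N, hN⟩ := pow_unbounded_of_one_lt (2 * C) (one_lt_two (α := ℝ))
  choose φ hφ1 hφ2 using fun k => exists_dual_vector'' 𝕜 (x N k)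
  have hsum : ∀ ε : Fin (m N) → ℤˣ,
      ∑ k, α N ^ r * ‖signedForm φ ε fun _ => x N k‖ ^ (r / 2) ≤ C := by
    intro ε
    have hinj : Function.Injective fun k : Fin (m N) => e.symm ⟨N, k⟩ :=
      e.symm.injective.comp sigma_mk_injective
    refine le_trans (le_of_eq ?_)
      (hC _ (norm_signedForm_le (hm N) φ hφ1 ε) (Finset.univ.map ⟨_, hinj⟩))
    rw [Finset.sum_map]
    refine Finset.sum_congr rfl fun k _ => ?_
    have h1 : y (e.symm ⟨N, k⟩) = (α N : 𝕜) • x N k := by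
      change (fun p : Σ N, Fin (m N) => (α p.1 : 𝕜) • x p.1 p.2) (e (e.symm ⟨N, k⟩)) = _
      rw [Equiv.apply_symm_apply]
    have h2 : (signedForm φ ε fun _ => (α N : 𝕜) • x N k) =
        (α N : 𝕜) ^ 2 * signedForm φ ε fun _ => x N k := by
      have := (signedForm φ ε).map_smul_univ (fun _ => (α N : 𝕜)) (fun _ => x N k)
      simpa using this
    simp only [Function.Embedding.coeFn_mk, h1, h2]
    rw [norm_mul, norm_pow, RCLike.norm_ofReal, abs_of_nonneg (hα0 N),
      Real.mul_rpow (by positivity) (norm_nonneg _), ← Real.rpow_natCast, ← Real.rpow_mul (hα0 N)]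
    congr 2
    push_cast
    ring
  have hlow : (2 : ℝ) ^ N / 2 ≤ C := by
    have h1 : 𝔼 ε : Fin (m N) → ℤˣ,
        ∑ k, α N ^ r * ‖signedForm φ ε fun _ => x N k‖ ^ (r / 2) ≤ C :=
      Finset.expect_le Finset.univ_nonempty fun ε _ => hsum ε
    refine le_trans ?_ h1
    rw [Finset.expect_sum_comm]
    simp only [← Finset.mul_expect]
    calc (2 : ℝ) ^ N / 2 = ∑ _k : Fin (m N), α N ^ r * ((1 / 2) * ((m N : ℝ)⁻¹) ^ (r / 2)) := by
          rw [Finset.sum_const, Finset.card_univ, Fintype.card_fin, nsmul_eq_mul, hαr,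
            Real.rpow_sub (hmR N), Real.rpow_one, Real.inv_rpow (hmR N).le]
          have h2 := hmR N
          have h3 : 0 < (m N : ℝ) ^ (r / 2) := Real.rpow_pos_of_pos h2 _
          field_simp
      _ ≤ _ := by
          refine Finset.sum_le_sum fun k _ => mul_le_mul_of_nonneg_left ?_
            (Real.rpow_nonneg (hα0 N) r)
          refine le_expect_norm_signedForm φ hρ0 hρ1 (x N k) k ?_
          rw [hφ2, RCLike.norm_ofReal, abs_norm]
          exact hx N k
  linarith

end DominatedPolynomials

/-! ### Conjugate exponents and conclusion. -/

theorem mul_one_sub_inv_lt_one_of_lt_conjExponent {q : ℝ≥0∞} (hq : 2 < q) {r : ℝ} (hr : 0 < r)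
    (hrq : ENNReal.ofReal r < ENNReal.conjExponent q) : r * (1 - (q⁻¹).toReal) < 1 := by
  rw [ENNReal.conjExponent] at hrq
  rcases eq_or_ne q ⊤ with rfl | hqt
  · have : r < 1 := by simpa [ENNReal.ofReal_lt_one] using hrq
    simpa using this
  · have hQ : 2 < q.toReal := by
      simpa using (ENNReal.toReal_lt_toReal (by simp) hqt).2 hq
    have hQ1 : q - 1 = ENNReal.ofReal (q.toReal - 1) := by
      rw [ENNReal.ofReal_sub _ zero_le_one, ENNReal.ofReal_toReal hqt, ENNReal.ofReal_one]
    have hlt : r < 1 + (q.toReal - 1)⁻¹ := by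
      have hpos : 0 < q.toReal - 1 := by linarith
      rw [hQ1, ← ENNReal.ofReal_inv_of_pos hpos, ← ENNReal.ofReal_one,
        ← ENNReal.ofReal_add zero_le_one (by positivity),
        ENNReal.ofReal_lt_ofReal_iff_of_nonneg hr.le] at hrq
      exact hrq
    rw [ENNReal.toReal_inv]
    have hpos : 0 < q.toReal - 1 := by linarith
    have h1 : 0 < 1 - q.toReal⁻¹ := by
      rw [sub_pos]; exact inv_lt_one_of_one_lt₀ (by linarith)
    calc r * (1 - q.toReal⁻¹) < (1 + (q.toReal - 1)⁻¹) * (1 - q.toReal⁻¹) := by gcongr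
      _ = 1 := by field_simp; ring

theorem dominatedHomPoly_ne_of_lt_conjExponent {𝕜 : Type*} [RCLike 𝕜] {X : Type*}
    [NormedAddCommGroup X] [NormedSpace 𝕜 X] (hq : 2 < cot X) {r : ℝ} (hr : 0 < r)
    (hrq : ENNReal.ofReal r < ENNReal.conjExponent (cot X)) :
    dominatedHomPoly 𝕜 r 2 X ≠ contHomPoly 𝕜 2 X := by
  have h := mul_one_sub_inv_lt_one_of_lt_conjExponent hq hr hrq
  have hκ : ((cot X)⁻¹).toReal < 1 / 2 := by
    have h1 : (cot X)⁻¹ < 2⁻¹ := ENNReal.inv_lt_inv.2 hq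
    simpa using (ENNReal.toReal_lt_toReal h1.ne_top (by simp)).2 h1
  exact dominatedHomPoly_ne_of_families hr (by nlinarith) fun ε hε => exists_family_weak hq hr h hε

theorem theorem2p4 {𝕜 : Type*} [RCLike 𝕜] {X : Type*} [NormedAddCommGroup X] [NormedSpace 𝕜 X]
    [CompleteSpace X] (q : ℝ≥0∞) (hcot : cot X = q) (hq : 2 < q) :
    (∀ r : ℝ, 1 ≤ r → ENNReal.ofReal r < ENNReal.conjExponent q →
      dominatedHomPoly 𝕜 r 2 X ≠ contHomPoly 𝕜 2 X) ∧
    ENNReal.conjExponent q ≤ dominatedIndex 𝕜 X := by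
  subst hcot
  refine ⟨fun r hr hrq => dominatedHomPoly_ne_of_lt_conjExponent hq (by linarith) hrq,
    le_iInf₂ fun r hr => ?_⟩
  -- The index also ranges over 0 < r < 1, which the argument covers.
  by_contra! hlt
  exact dominatedHomPoly_ne_of_lt_conjExponent hq hr.1 hlt hr.2
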